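/- Let $d\ge 1$ and $\alpha\in(0,2)$, let $\lambda\neq 0$ be a finite Borel measure on the unit sphere $S^{d-1}\subset\mathbb{R}^d$, let $\beta:S^{d-1}\to(0,\infty)$ be Borel measurable, and let $q>0$. Let $\nu$ be the exponential tempered $\alpha$-stable ($\mathcal{E}T\alpha S$) Lévy measure $$\nu(E)=\int_{S^{d-1}}\int_0^\infty \mathbf 1_E(r\boldsymbol w)\,\frac{e^{-\beta(\boldsymbol w)r}}{r^{\alpha+1}}\,dr\,\lambda(d\boldsymbol w),\qquad E\in\mathcal B(\mathbb{R}^d),$$ and write $S_+^{d-1}=\{\boldsymbol w\in S^{d-1}: w_i\ge 0,\ i=1,\dots,d\}$. An infinitely divisible probability measure on $\mathbb{R}^d$ without Gaussian part and with Lévy measure $\nu$ is denoted $\mathcal{E}T\alpha S(\alpha,\beta,\lambda)$. A Sato process with exponent $q$ is an additive process $\boldsymbol S=(\boldsymbol S(t))_{t\ge0}$ in $\mathbb{R}^d$ (that is, $\boldsymbol S(0)=0$ a.s., independent increments, stochastically continuous, a.s. càdlàg paths) such that, for every $a>0$, the processes $(\boldsymbol S(at))_{t\ge 0}$ and $(a^q\boldsymbol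 S(t))_{t\ge0}$ have the same law. It is a Sato subordinator if, almost surely, all its coordinate paths are nonnegative and increasing (in the non-strict sense). Then there exists a Sato subordinator $\boldsymbol S$ with exponent $q$ such that $\boldsymbol S(1)\sim\mathcal{E}T\alpha S(\alpha,\beta,\lambda)$ (so that $\nu$ is the Lévy measure of $\boldsymbol S(1)$) if and only if $\alpha\in(0,1)$ and $\lambda$ is supported on $S_+^{d-1}$, i.e. $\lambda(S^{d-1}\setminus S_+^{d-1})=0$. The same equivalence holds if $\boldsymbol S$ is moreover required to have zero drift, i.e. $\int_{\|\boldsymbol x\|\le1}\|\boldsymbol x\|\,\nu(d\boldsymbol x)<\infty$ and $\mathbb{E}\,e^{i\langle \boldsymbol z,\boldsymbol S(1)\rangle}=\exp\int_{\mathbb{R}^d}(e^{i\langle \boldsymbol z,\boldsymbol x\rangle}-1)\,\nu(d\boldsymbol x)$ for all $\boldsymbol z\in\mathbb{R}^d$. -/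

import Mathlib

open MeasureTheory ProbabilityTheory Filter Topology
open scoped NNReal ENNReal RealInnerProductSpace

universe u

noncomputable section

namespace ETaS

/-- `ℝ^d` with its Euclidean norm. -/
abbrev Space (d : ℕ) : Type := EuclideanSpace ℝ (Fin d)

/-- The unit sphere `S^{d-1}` of `ℝ^d`. -/
abbrev Sphere (d : ℕ) : Type := Metric.sphere (0 : Space d) 1

/-- `S_+^{d-1}`: the unit vectors all of whose coordinates are nonnegative. -/
def positiveSphere (d : ℕ) : Set (Sphere d) := {w | ∀ i, 0 ≤ (w : Space d) i}

/-! ### The exponential tempered stable Lévy measure -/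

/-- The measure on `ℝ^d` with polar decomposition
`ν(E) = ∫_{S^{d-1}} ∫_0^∞ 1_E(r w) e^{-β(w) r} / r^{α+1} dr λ(dw)`:
the image under `(w, r) ↦ r w` of the measure with density `e^{-β(w) r} / r^{α+1}`
with respect to `λ(dw) dr` on `S^{d-1} × (0, ∞)`. -/
def levyMeasure {d : ℕ} (α : ℝ) (β : Sphere d → ℝ) (lam : Measure (Sphere d)) :
    Measure (Space d) :=
  ((lam.prod (volume.restrict (Set.Ioi (0 : ℝ)))).withDensity
    (fun p => ENNReal.ofReal (Real.exp (-β p.1 * p.2) / p.2 ^ (α + 1)))).map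
    (fun p => p.2 • (p.1 : Space d))

/-! ### Infinitely divisible laws -/

/-- `μ` is infinitely divisible: for each `n ≥ 1` it is the law of the sum of `n` independent
random vectors with a common law `ρ`. -/
def IsInfinitelyDivisible {d : ℕ} (μ : Measure (Space d)) : Prop :=
  ∀ n : ℕ, 1 ≤ n → ∃ ρ : Measure (Space d), IsProbabilityMeasure ρ ∧
    μ = (Measure.pi (fun _ : Fin n => ρ)).map (fun x => ∑ i, x i)

/-- `ν` is a Lévy measure: `ν({0}) = 0` and `∫ (‖x‖² ∧ 1) ν(dx) < ∞`. -/
def IsLevyMeasure {d : ℕ} (ν : Measure (Space d)) : Prop :=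
  ν {0} = 0 ∧ ∫⁻ x, ENNReal.ofReal (min (‖x‖ ^ 2) 1) ∂ν < ∞

/-- The characteristic function of `μ` has the Lévy–Khintchine form without Gaussian part, with
vector `γ` and Lévy measure `ν` (truncation function `1_{‖x‖ ≤ 1}`). -/
def HasLevyKhintchine {d : ℕ} (μ : Measure (Space d)) (γ : Space d) (ν : Measure (Space d)) :
    Prop :=
  IsLevyMeasure ν ∧ ∀ z : Space d, charFun μ z =
    Complex.exp (Complex.I * (⟪γ, z⟫ : ℝ) +
      ∫ x, (Complex.exp (Complex.I * (⟪z, x⟫ : ℝ)) - 1 -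
        (Metric.closedBall (0 : Space d) 1).indicator (fun y => Complex.I * (⟪z, y⟫ : ℝ)) x) ∂ν)

/-- `μ ∼ ETαS(α, β, λ)`: an infinitely divisible probability measure without Gaussian part
whose Lévy measure is `levyMeasure α β λ`. -/
def IsETaSLaw {d : ℕ} (α : ℝ) (β : Sphere d → ℝ) (lam : Measure (Sphere d))
    (μ : Measure (Space d)) : Prop :=
  IsProbabilityMeasure μ ∧ IsInfinitelyDivisible μ ∧
    ∃ γ : Space d, HasLevyKhintchine μ γ (levyMeasure α β lam)

/-- `μ` has Lévy measure `ν`, with `∫_{‖x‖ ≤ 1} ‖x‖ ν(dx) < ∞`, no Gaussian part and zero drift: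
`μ̂(z) = exp ∫ (e^{i⟨z,x⟩} - 1) ν(dx)`. -/
def HasZeroDrift {d : ℕ} (μ ν : Measure (Space d)) : Prop :=
  ∫⁻ x in Metric.closedBall (0 : Space d) 1, ‖x‖ₑ ∂ν < ∞ ∧
    ∀ z : Space d, charFun μ z =
      Complex.exp (∫ x, (Complex.exp (Complex.I * (⟪z, x⟫ : ℝ)) - 1) ∂ν)

/-! ### Additive processes, Sato processes, Sato subordinators -/

section Paths

variable {d : ℕ} {Ω : Type u} [MeasurableSpace Ω]

/-- Right-continuous paths with left limits. -/
def IsCadlagPath (f : ℝ≥0 → Space d) : Prop :=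
  ∀ t, ContinuousWithinAt f (Set.Ici t) t ∧ ∃ l, Tendsto f (𝓝[<] t) (𝓝 l)

/-- An additive process on `[0, ∞)`: a stochastically continuous process with independent
(not necessarily stationary) increments, started at `0`, with càdlàg paths almost surely. -/
structure IsAdditiveProcess (X : ℝ≥0 → Ω → Space d) (P : Measure Ω) : Prop where
  measurable : ∀ t, Measurable (X t)
  indep_increments : HasIndepIncrements X P
  start_zero : ∀ᵐ ω ∂P, X 0 ω = 0
  stoch_continuous : ∀ t, TendstoInMeasure P X (𝓝 t) (X t)
  cadlag : ∀ᵐ ω ∂P, IsCadlagPath (fun t => X t ω)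

/-- `q`-self-similarity: for each `a > 0` the processes `(X (a t))_t` and `(a^q X t)_t` have the
same law (on the path space with the product σ-algebra, that is, the same finite-dimensional
distributions). -/
def IsSelfSimilar (q : ℝ) (X : ℝ≥0 → Ω → Space d) (P : Measure Ω) : Prop :=
  ∀ a : ℝ≥0, 0 < a →
    IdentDistrib (fun ω t => X (a * t) ω) (fun ω t => (a : ℝ) ^ q • X t ω) P P

/-- A Sato process with exponent `q`: a `q`-self-similar additive process. -/
structure IsSatoProcess (q : ℝ) (X : ℝ≥0 → Ω → Space d) (P : Measure Ω) : Prop where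
  additive : IsAdditiveProcess X P
  selfSimilar : IsSelfSimilar q X P

/-- A Sato subordinator with exponent `q`: a Sato process each of whose one-dimensional
coordinate paths is, almost surely, nonnegative and increasing. -/
structure IsSatoSubordinator (q : ℝ) (X : ℝ≥0 → Ω → Space d) (P : Measure Ω) : Prop where
  sato : IsSatoProcess q X P
  nonneg : ∀ᵐ ω ∂P, ∀ i t, 0 ≤ X t ω i
  increasing : ∀ᵐ ω ∂P, ∀ i, Monotone (fun t => X t ω i)

end Paths

/-- There is a Sato subordinator `S` with exponent `q`, on some probability space, such that
`S(1) ∼ ETαS(α, β, λ)`; in particular `levyMeasure α β λ` is the Lévy measure of `S(1)`. -/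
def ExistsSatoSubordinator {d : ℕ} (q α : ℝ) (β : Sphere d → ℝ) (lam : Measure (Sphere d)) :
    Prop :=
  ∃ (Ω : Type u) (_ : MeasurableSpace Ω) (P : Measure Ω) (S : ℝ≥0 → Ω → Space d),
    IsProbabilityMeasure P ∧ IsSatoSubordinator q S P ∧ IsETaSLaw α β lam (P.map (S 1))

/-- The same, with a Sato subordinator whose drift is zero. -/
def ExistsDriftlessSatoSubordinator {d : ℕ} (q α : ℝ) (β : Sphere d → ℝ)
    (lam : Measure (Sphere d)) : Prop :=
  ∃ (Ω : Type u) (_ : MeasurableSpace Ω) (P : Measure Ω) (S : ℝ≥0 → Ω → Space d),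
    IsProbabilityMeasure P ∧ IsSatoSubordinator q S P ∧ IsETaSLaw α β lam (P.map (S 1)) ∧
      HasZeroDrift (P.map (S 1)) (levyMeasure α β lam)

end ETaS

end

/-! Sufficiency. In the variable x = log r the radial density of `ν` becomes `logDensity`,
proportional to exp(-αx - β(w)e^x), which decreases in x. Self-similarity forces the Lévy measure at
time t to be `ν` dilated by t^q, that is, this density translated by q log t; because the density
decreases, these measures increase with t. Take Poisson points ((w, x), u) with intensity λ ⊗ dx ⊗
du and let a point contribute the jump e^x w once u lies below the density at time t. Every point
then jumps at most once, with a size independent of the time. For α < 1 the jumps are summable, so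
no compensation is needed and the process is a plain sum. Increments over disjoint intervals use
disjoint sets of points, hence are independent (`hasIndepIncrements_atomSum_jump`). Translating x by
q log a preserves the intensity and carries time t to time at while multiplying jumps by a^q
(`jump_scaleEquiv`), hence self-similarity. Dominated convergence of the series gives the path
properties. If λ lives on the positive part of the sphere, each term is coordinatewise nonnegative
and increasing.

Necessity. Only the law μ of S(1) matters: it is infinitely divisible and its coordinates are
nonnegative. Its n-th convolution roots are nonnegative too. Since e^{-|x|} is the Fourier transform
of the Cauchy law, the Laplace transform of a root is a Cauchy average of its characteristic
function. Comparing moduli and letting n grow bounds the Cauchy average of -log|μ̂|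
(`lintegral_neg_log_charFun_lt_top`). By Tonelli this average is ∫ (1 - e^{-|x_i|}) dν, which is
infinite for some i when α ≥ 1, because the small jumps are then not summable. So α < 1, and μ is a
translate of a driftless law. If `ν` charged {x_i < 0}, then μ would have a compound Poisson
convolution factor taking arbitrarily negative i-th coordinates with positive probability,
contradicting nonnegativity (`coord_nonneg_of_charFun`). Reading `ν` in polar coordinates then
locates λ. -/

namespace ETaS

/-! ### Poisson point processes -/

/-- The sum of `f` over the active points `p i`, where the `i`-th point is active on `A i`. -/
noncomputable def atomSum {Ω E ι V : Type*} [AddCommMonoid V] [TopologicalSpace V]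
    (A : ι → Set Ω) (p : ι → Ω → E) (f : E → V) (ω : Ω) : V :=
  ∑' i, (A i).indicator (fun ω => f (p i ω)) ω

/-- The active points form a Poisson point process with intensity `m`: measurability, Campbell's
formula and the characteristic functional. -/
structure IsPoissonPoints {Ω E : Type*} [MeasurableSpace Ω] [MeasurableSpace E] (m : Measure E)
    (P : Measure Ω) (A : ℕ × ℕ → Set Ω) (p : ℕ × ℕ → Ω → E) : Prop where
  measurableSet : ∀ i, MeasurableSet (A i)
  measurable : ∀ i, Measurable (p i)
  campbell : ∀ f : E → ℝ≥0∞, Measurable f → ∫⁻ ω, atomSum A p f ω ∂P = ∫⁻ x, f x ∂m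
  charFunctional : ∀ g : E → ℝ, Measurable g → ∫⁻ x, min ‖g x‖ₑ 1 ∂m < ∞ →
    ∫ ω, Complex.exp (Complex.I * (atomSum A p g ω : ℝ)) ∂P =
      Complex.exp (∫ x, (Complex.exp (Complex.I * (g x : ℝ)) - 1) ∂m)

lemma lintegral_natCast_poissonMeasure (r : ℝ≥0) :
    ∫⁻ n, (n : ℝ≥0∞) ∂(poissonMeasure r) = r := by
  have h : HasSum (fun n : ℕ => Real.exp (-r) * r ^ n / n.factorial * n) (r : ℝ) := by
    rw [← hasSum_nat_add_iff' 1]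
    have := (hasSum_one_poissonMeasure r).mul_left (r : ℝ)
    have h1 : (r : ℝ) - ∑ i ∈ Finset.range 1, Real.exp (-r) * r ^ i / i.factorial * i = r * 1 := by
      simp
    rw [h1]
    convert! this using 2 with n
    rw [Nat.factorial_succ]
    push_cast
    field_simp
    ring
  rw [poissonMeasure, lintegral_sum_measure]
  simp only [lintegral_smul_measure, lintegral_dirac, smul_eq_mul]
  have h2 : ∀ n : ℕ, ENNReal.ofReal (Real.exp (-r) * r ^ n / n.factorial) * (n : ℝ≥0∞) =
      ENNReal.ofReal (Real.exp (-r) * r ^ n / n.factorial * n) := fun n => by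
    rw [ENNReal.ofReal_mul (by positivity), ENNReal.ofReal_natCast]
  simp_rw [h2]
  rw [← ENNReal.ofReal_tsum_of_nonneg (fun n => by positivity) h.summable, h.tsum_eq]
  simp

/-! ### Compound Poisson blocks with finite intensity. -/

section Block

variable {E : Type*} [MeasurableSpace E]

/-- The law of a Poisson number of i.i.d. points. -/
noncomputable def poissonBlock (r : ℝ≥0) (π : Measure E) [IsProbabilityMeasure π] :
    Measure (ℕ × (ℕ → E)) :=
  (poissonMeasure r).prod (Measure.infinitePi fun _ : ℕ => π)

instance (r : ℝ≥0) (π : Measure E) [IsProbabilityMeasure π] :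
    IsProbabilityMeasure (poissonBlock r π) := by
  unfold poissonBlock; infer_instance

lemma measurable_sum_range {V : Type*} [AddCommMonoid V] [MeasurableSpace V] [MeasurableAdd₂ V]
    {f : E → V} (hf : Measurable f) :
    Measurable (fun b : ℕ × (ℕ → E) => ∑ j ∈ Finset.range b.1, f (b.2 j)) := by
  refine measurable_from_prod_countable_right fun n => ?_
  exact Finset.measurable_fun_sum (Finset.range n)
    (f := fun j (x : ℕ → E) => f (x j)) fun j _ => hf.comp (measurable_pi_apply j)

lemma lintegral_sum_poissonBlock (r : ℝ≥0) (π : Measure E) [IsProbabilityMeasure π]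
    {f : E → ℝ≥0∞} (hf : Measurable f) :
    ∫⁻ b, ∑ j ∈ Finset.range b.1, f (b.2 j) ∂(poissonBlock r π) = r * ∫⁻ x, f x ∂π := by
  rw [poissonBlock, lintegral_prod _ (measurable_sum_range hf).aemeasurable]
  have h : ∀ n : ℕ, ∫⁻ x : ℕ → E, ∑ j ∈ Finset.range n, f (x j)
      ∂(Measure.infinitePi fun _ : ℕ => π) = n * ∫⁻ x, f x ∂π := fun n => by
    rw [lintegral_finsetSum _ fun j _ => by fun_prop]
    have : ∀ j : ℕ, ∫⁻ x : ℕ → E, f (x j) ∂(Measure.infinitePi fun _ : ℕ => π) =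
        ∫⁻ x, f x ∂π := fun j =>
      (measurePreserving_eval_infinitePi (fun _ : ℕ => π) j).lintegral_comp hf
    simp [this]
  simp only [h]
  rw [lintegral_mul_const _ (by fun_prop), lintegral_natCast_poissonMeasure]

/-- Given that the number of points is n, independence yields the n-th power of the one-point
characteristic function; averaging over n sums an exponential series. -/
lemma integral_exp_sum_poissonBlock (r : ℝ≥0) (π : Measure E) [IsProbabilityMeasure π]
    {g : E → ℝ} (hg : Measurable g) :
    ∫ b, Complex.exp (Complex.I * (∑ j ∈ Finset.range b.1, g (b.2 j) : ℝ)) ∂(poissonBlock r π) =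
      Complex.exp (r * (∫ x, Complex.exp (Complex.I * (g x : ℝ)) ∂π - 1)) := by
  have hmeas : Measurable (fun b : ℕ × (ℕ → E) =>
      Complex.exp (Complex.I * (∑ j ∈ Finset.range b.1, g (b.2 j) : ℝ))) := by
    have := measurable_sum_range hg
    fun_prop
  rw [poissonBlock, integral_prod]
  swap
  · refine (integrable_const (1 : ℝ)).mono' hmeas.aestronglyMeasurable (ae_of_all _ fun b => ?_)
    rw [mul_comm, Complex.norm_exp_ofReal_mul_I]
  have h : ∀ n : ℕ, ∫ x : ℕ → E, Complex.exp (Complex.I * (∑ j ∈ Finset.range n, g (x j) : ℝ))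
      ∂(Measure.infinitePi fun _ : ℕ => π) = (∫ x, Complex.exp (Complex.I * (g x : ℝ)) ∂π) ^ n := by
    intro n
    have hE : ∀ j : ℕ, ∫ x : ℕ → E, Complex.exp (Complex.I * (g (x j) : ℝ))
        ∂(Measure.infinitePi fun _ : ℕ => π) = ∫ x, Complex.exp (Complex.I * (g x : ℝ)) ∂π := by
      intro j
      have hj := (measurePreserving_eval_infinitePi (fun _ : ℕ => π) j).map_eq
      conv_rhs => rw [← hj]
      rw [integral_map (measurable_pi_apply j).aemeasurable
        (Measurable.aestronglyMeasurable (by fun_prop))]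
    have hi : iIndepFun (fun (j : Fin n) (x : ℕ → E) => x j) (Measure.infinitePi fun _ : ℕ => π) :=
      (iIndepFun_infinitePi (P := fun _ : ℕ => π) (X := fun _ x => x)
        (fun _ => measurable_id)).precomp Fin.val_injective
    have := hi.integral_fun_prod_comp (f := fun _ x => Complex.exp (Complex.I * (g x : ℝ)))
      (fun j => (measurable_pi_apply _).aemeasurable)
      (fun j => Measurable.aestronglyMeasurable (by fun_prop))
    simp only [hE, Finset.prod_const, Finset.card_univ, Fintype.card_fin] at this
    rw [← this]
    refine integral_congr_ae (ae_of_all _ fun x => ?_)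
    simp only
    rw [← Complex.exp_sum, ← Finset.mul_sum, Finset.sum_range]
    simp
  simp only [h]
  rw [integral_poissonMeasure]
  set z := ∫ x, Complex.exp (Complex.I * (g x : ℝ)) ∂π
  have h2 : ∀ n : ℕ, (Real.exp (-r) * (r : ℝ) ^ n / n.factorial) • z ^ n =
      Complex.exp (-(r : ℂ)) * ((r * z) ^ n / n.factorial) := fun n => by
    rw [Complex.real_smul]
    push_cast
    rw [mul_pow]; ring
  simp_rw [h2]
  rw [tsum_mul_left, mul_sub, mul_one, sub_eq_neg_add, Complex.exp_add]
  congr 1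
  rw [Complex.exp_eq_exp_ℂ]
  exact (NormedSpace.expSeries_div_hasSum_exp (r * z)).tsum_eq

end Block

lemma atomSum_comp {Ω Ω' E ι V : Type*} [AddCommMonoid V] [TopologicalSpace V] (A : ι → Set Ω)
    (p : ι → Ω → E) (f : E → V) (e : Ω' → Ω) (ω : Ω') :
    atomSum (fun i => e ⁻¹' A i) (fun i => p i ∘ e) f ω = atomSum A p f (e ω) := rfl

/-! ### Summability over the active points. -/

section AtomSum

variable {Ω E ι V : Type*}

lemma min_indicator_one (s : Set Ω) (f : Ω → ℝ≥0∞) (ω : Ω) :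
    min (s.indicator f ω) 1 = s.indicator (fun ω => min (f ω) 1) ω := by
  by_cases h : ω ∈ s <;> simp [h]

/-- Summability forces all but finitely many truncated terms below 1, where truncation has no
effect. -/
lemma summable_norm_of_tsum_min_one [SeminormedAddCommGroup V] {a : ι → V}
    (h : ∑' i, min ‖a i‖ₑ 1 ≠ ∞) : Summable fun i => ‖a i‖ := by
  have hs := ENNReal.summable_toReal h
  have hev : ∀ᶠ i in cofinite, (min ‖a i‖ₑ 1).toReal < 1 :=
    hs.tendsto_cofinite_zero.eventually (gt_mem_nhds one_pos)
  refine hs.congr_cofinite ?_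
  filter_upwards [hev] with i hi
  rcases le_total ‖a i‖ₑ 1 with h1 | h1
  · simp [min_eq_left h1]
  · simp [min_eq_right h1] at hi

variable [NormedAddCommGroup V] [MeasurableSpace Ω] [MeasurableSpace E] [MeasurableSpace V]
  {m : Measure E} {P : Measure Ω} {A : ℕ × ℕ → Set Ω} {p : ℕ × ℕ → Ω → E}

lemma measurable_atomSum [BorelSpace V] [CompleteSpace V] [SecondCountableTopology V]
    (hA : ∀ i, MeasurableSet (A i)) (hp : ∀ i, Measurable (p i)) {f : E → V} (hf : Measurable f) :
    Measurable (atomSum A p f) :=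
  Measurable.tsum fun i => (hf.comp (hp i)).indicator (hA i)

lemma ae_summable_norm_of_campbell [OpensMeasurableSpace V]
    (hA : ∀ i, MeasurableSet (A i)) (hp : ∀ i, Measurable (p i))
    (hC : ∀ f : E → ℝ≥0∞, Measurable f → ∫⁻ ω, atomSum A p f ω ∂P = ∫⁻ x, f x ∂m)
    {f : E → V} (hf : Measurable f) (hfin : ∫⁻ x, min ‖f x‖ₑ 1 ∂m < ∞) :
    ∀ᵐ ω ∂P, Summable fun i => ‖(A i).indicator (fun ω => f (p i ω)) ω‖ := by
  have hmeas : Measurable fun x => min ‖f x‖ₑ 1 := hf.enorm.min measurable_const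
  have h1 := hC _ hmeas
  have h2 : Measurable (atomSum A p fun x => min ‖f x‖ₑ 1) :=
    Measurable.tsum fun i => (hmeas.comp (hp i)).indicator (hA i)
  have h3 := ae_lt_top h2 (h1.trans_lt hfin).ne
  filter_upwards [h3] with ω hω
  refine summable_norm_of_tsum_min_one (ne_of_lt ?_)
  simp only [enorm_indicator_eq_indicator_enorm, min_indicator_one]
  exact hω

lemma lintegral_enorm_exp_sub_one_le {g : E → ℝ} :
    ∫⁻ x, ‖Complex.exp (Complex.I * (g x : ℝ)) - 1‖ₑ ∂m ≤ 2 * ∫⁻ x, min ‖g x‖ₑ 1 ∂m := by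
  rw [← lintegral_const_mul' _ _ (by simp)]
  refine lintegral_mono fun x => ?_
  rw [mul_min]
  refine le_min ?_ ?_
  · refine Real.enorm_exp_I_mul_ofReal_sub_one_le.trans ?_
    exact le_mul_of_one_le_left zero_le (by norm_num)
  · refine enorm_sub_le.trans ?_
    rw [← ofReal_norm, mul_comm, Complex.norm_exp_ofReal_mul_I]
    simp [one_add_one_eq_two]

lemma integrable_exp_sub_one {g : E → ℝ} (hg : Measurable g)
    (hfin : ∫⁻ x, min ‖g x‖ₑ 1 ∂m < ∞) :
    Integrable (fun x => Complex.exp (Complex.I * (g x : ℝ)) - 1) m :=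
  ⟨Measurable.aestronglyMeasurable (by fun_prop),
    lintegral_enorm_exp_sub_one_le.trans_lt (ENNReal.mul_lt_top (by simp) hfin)⟩

end AtomSum

/-! ### Existence of Poisson points with s-finite intensity. -/

section Existence

variable {E : Type*} [MeasurableSpace E]

/-- Superposition of independent finite blocks: the point (k, j) is the j-th point of block k,
active when j is less than that block's Poisson count. Finitely many blocks give a product by
independence, and dominated convergence passes to all blocks. -/
lemma isPoissonPoints_infinitePi (r : ℕ → ℝ≥0) (π : ℕ → Measure E)
    [∀ k, IsProbabilityMeasure (π k)] :
    IsPoissonPoints (Measure.sum fun k => r k • π k)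
      (Measure.infinitePi fun k => poissonBlock (r k) (π k))
      (fun i => {ω | i.2 < (ω i.1).1}) (fun i ω => (ω i.1).2 i.2) := by
  have hA : ∀ i : ℕ × ℕ, MeasurableSet {ω : ℕ → ℕ × (ℕ → E) | i.2 < (ω i.1).1} := fun i =>
    measurableSet_lt measurable_const (by fun_prop)
  have hp : ∀ i : ℕ × ℕ, Measurable (fun ω : ℕ → ℕ × (ℕ → E) => (ω i.1).2 i.2) := fun i => by
    fun_prop
  have hfib : ∀ {V : Type} [AddCommMonoid V] [TopologicalSpace V] (f : E → V)
      (ω : ℕ → ℕ × (ℕ → E)) (k : ℕ),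
      HasSum (fun j => Set.indicator {ω : ℕ → ℕ × (ℕ → E) | j < (ω k).1}
        (fun ω => f ((ω k).2 j)) ω) (∑ j ∈ Finset.range (ω k).1, f ((ω k).2 j)) := by
    intro V _ _ f ω k
    have := hasSum_sum_of_ne_finset_zero (s := Finset.range (ω k).1)
      (f := fun j => Set.indicator {ω : ℕ → ℕ × (ℕ → E) | j < (ω k).1}
        (fun ω => f ((ω k).2 j)) ω) (L := .unconditional _) fun j hj => by
          simpa [Set.indicator_apply] using fun h => absurd h (by simpa using hj)
    convert this using 1
    refine Finset.sum_congr rfl fun j hj => ?_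
    have hjω : ω ∈ {ω : ℕ → ℕ × (ℕ → E) | j < (ω k).1} := by simpa using hj
    exact (Set.indicator_of_mem hjω fun ω => f ((ω k).2 j)).symm
  have hC : ∀ f : E → ℝ≥0∞, Measurable f →
      ∫⁻ ω, atomSum (fun i : ℕ × ℕ => {ω : ℕ → ℕ × (ℕ → E) | i.2 < (ω i.1).1})
        (fun i ω => (ω i.1).2 i.2) f ω ∂(Measure.infinitePi fun k => poissonBlock (r k) (π k)) =
      ∫⁻ x, f x ∂(Measure.sum fun k => r k • π k) := by
    intro f hf
    have h1 : ∀ ω, atomSum (fun i : ℕ × ℕ => {ω : ℕ → ℕ × (ℕ → E) | i.2 < (ω i.1).1})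
        (fun i ω => (ω i.1).2 i.2) f ω = ∑' k, ∑ j ∈ Finset.range (ω k).1, f ((ω k).2 j) := by
      intro ω
      unfold atomSum
      rw [ENNReal.tsum_prod' (f := fun i : ℕ × ℕ => Set.indicator
        {ω : ℕ → ℕ × (ℕ → E) | i.2 < (ω i.1).1} (fun ω => f ((ω i.1).2 i.2)) ω)]
      exact tsum_congr fun k => (hfib f ω k).tsum_eq
    simp only [h1]
    have hmk : ∀ k, Measurable fun ω : ℕ → ℕ × (ℕ → E) =>
        ∑ j ∈ Finset.range (ω k).1, f ((ω k).2 j) := fun k =>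
      (measurable_sum_range hf).comp (measurable_pi_apply k)
    rw [lintegral_tsum fun k => (hmk k).aemeasurable, lintegral_sum_measure]
    refine tsum_congr fun k => ?_
    rw [lintegral_smul_measure, ← (measurePreserving_eval_infinitePi
      (fun k => poissonBlock (r k) (π k)) k).lintegral_comp (measurable_sum_range hf) |>.symm,
      lintegral_sum_poissonBlock _ _ hf]
    rfl
  refine ⟨hA, hp, hC, fun g hg hfin => ?_⟩
  set P := Measure.infinitePi fun k => poissonBlock (r k) (π k)
  have hsum := ae_summable_norm_of_campbell hA hp hC hg hfin
  set Y : ℕ → (ℕ → ℕ × (ℕ → E)) → ℝ := fun k ω => ∑ j ∈ Finset.range (ω k).1, g ((ω k).2 j)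
    with hY
  have hYm : ∀ k, Measurable (Y k) := fun k =>
    (measurable_sum_range hg).comp (measurable_pi_apply k)
  have hlim : ∀ᵐ ω ∂P, Tendsto (fun K => ∑ k ∈ Finset.range K, Y k ω) atTop
      (𝓝 (atomSum (fun i : ℕ × ℕ => {ω : ℕ → ℕ × (ℕ → E) | i.2 < (ω i.1).1})
        (fun i ω => (ω i.1).2 i.2) g ω)) := by
    filter_upwards [hsum] with ω hω
    have h1 : HasSum _ _ := (Summable.of_norm hω).hasSum
    exact (h1.prod_fiberwise fun k => hfib g ω k).tendsto_sum_nat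
  have hL : Tendsto (fun K => ∫ ω, Complex.exp (Complex.I * (∑ k ∈ Finset.range K, Y k ω : ℝ)) ∂P)
      atTop (𝓝 (∫ ω, Complex.exp (Complex.I * (atomSum
        (fun i : ℕ × ℕ => {ω : ℕ → ℕ × (ℕ → E) | i.2 < (ω i.1).1})
        (fun i ω => (ω i.1).2 i.2) g ω : ℝ)) ∂P)) := by
    refine tendsto_integral_of_dominated_convergence (fun _ => 1)
      (fun K => Measurable.aestronglyMeasurable ?_) (integrable_const _)
      (fun K => ae_of_all _ fun ω => ?_) ?_
    · have := Finset.measurable_fun_sum (Finset.range K) fun k _ => hYm k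
      fun_prop
    · rw [mul_comm, Complex.norm_exp_ofReal_mul_I]
    · filter_upwards [hlim] with ω hω
      refine Tendsto.cexp (Tendsto.const_mul _ ?_)
      exact (Complex.continuous_ofReal.tendsto _).comp hω
  have hR : Tendsto (fun K => Complex.exp (∑ k ∈ Finset.range K,
      ∫ x, (Complex.exp (Complex.I * (g x : ℝ)) - 1) ∂(r k • π k))) atTop
      (𝓝 (Complex.exp (∫ x, (Complex.exp (Complex.I * (g x : ℝ)) - 1)
        ∂(Measure.sum fun k => r k • π k)))) :=
    (hasSum_integral_measure (integrable_exp_sub_one hg hfin)).tendsto_sum_nat.cexp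
  refine tendsto_nhds_unique hL (hR.congr fun K => ?_)
  have hi : iIndepFun (fun (k : Fin K) (ω : ℕ → ℕ × (ℕ → E)) => Y k ω) P :=
    (iIndepFun_infinitePi (P := fun k => poissonBlock (r k) (π k))
      (X := fun _ b => ∑ j ∈ Finset.range b.1, g (b.2 j))
        (fun _ => measurable_sum_range hg)).precomp Fin.val_injective
  have hprod := hi.integral_fun_prod_comp (f := fun _ (y : ℝ) => Complex.exp (Complex.I * y))
    (fun k => (hYm k).aemeasurable) (fun j => Measurable.aestronglyMeasurable (by fun_prop))
  have hone : ∀ k, ∫ ω, Complex.exp (Complex.I * (Y k ω : ℝ)) ∂P =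
      Complex.exp (∫ x, (Complex.exp (Complex.I * (g x : ℝ)) - 1) ∂(r k • π k)) := by
    intro k
    have hk := (measurePreserving_eval_infinitePi (fun k => poissonBlock (r k) (π k)) k).map_eq
    have h2 := integral_exp_sum_poissonBlock (r k) (π k) hg
    have h3 : Measurable (fun b : ℕ × (ℕ → E) =>
        Complex.exp (Complex.I * (∑ j ∈ Finset.range b.1, g (b.2 j) : ℝ))) := by
      have := measurable_sum_range hg
      fun_prop
    rw [← hk, integral_map (measurable_pi_apply k).aemeasurable h3.aestronglyMeasurable] at h2
    refine h2.trans ?_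
    congr 1
    rw [integral_smul_nnreal_measure, integral_sub, integral_const]
    · simp [NNReal.smul_def]
    · refine (integrable_const (1 : ℝ)).mono' (Measurable.aestronglyMeasurable (by fun_prop))
        (ae_of_all _ fun b => ?_)
      rw [mul_comm, Complex.norm_exp_ofReal_mul_I]
    · exact integrable_const _
  simp only [hone] at hprod
  rw [Complex.exp_sum, Finset.prod_range, ← hprod]
  refine integral_congr_ae (ae_of_all _ fun ω => ?_)
  simp only
  rw [← Complex.exp_sum, ← Finset.mul_sum, Finset.sum_range]
  simp

lemma IsPoissonPoints.comp_measurableEquiv {Ω Ω' : Type*} [MeasurableSpace Ω] [MeasurableSpace Ω']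
    {m : Measure E} {P : Measure Ω} {A : ℕ × ℕ → Set Ω} {p : ℕ × ℕ → Ω → E}
    (h : IsPoissonPoints m P A p) (e : Ω' ≃ᵐ Ω) :
    IsPoissonPoints m (P.map e.symm) (fun i => e ⁻¹' A i) (fun i => p i ∘ e) where
  measurableSet i := e.measurable (h.measurableSet i)
  measurable i := (h.measurable i).comp e.measurable
  campbell f hf := by
    rw [lintegral_map_equiv, ← h.campbell f hf]
    simp [atomSum_comp]
  charFunctional g hg hfin := by
    rw [integral_map_equiv, ← h.charFunctional g hg hfin]
    simp [atomSum_comp]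

lemma exists_smul_isProbabilityMeasure [Nonempty E] (m : Measure E) [IsFiniteMeasure m] :
    ∃ (r : ℝ≥0) (π : Measure E), IsProbabilityMeasure π ∧ m = r • π := by
  by_cases h : m = 0
  -- At rate zero the law of the points is irrelevant; nonemptiness of `E` only supplies some
  -- probability measure here.
  · exact ⟨0, Measure.dirac (Classical.arbitrary E), inferInstance, by simp [h]⟩
  · have : NeZero m := ⟨h⟩
    refine ⟨(m Set.univ).toNNReal, (m Set.univ)⁻¹ • m, inferInstance, ?_⟩
    ext s hs
    rw [Measure.smul_apply, Measure.smul_apply, ENNReal.smul_def, smul_eq_mul, smul_eq_mul,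
      ENNReal.coe_toNNReal (measure_ne_top _ _), ← mul_assoc, ENNReal.mul_inv_cancel, one_mul]
    · simpa using h
    · exact measure_ne_top _ _

theorem exists_isPoissonPoints {E : Type} [MeasurableSpace E] [Nonempty E] (m : Measure E)
    [SFinite m] :
    ∃ (Ω : Type u) (_ : MeasurableSpace Ω) (P : Measure Ω) (A : ℕ × ℕ → Set Ω)
      (p : ℕ × ℕ → Ω → E), IsProbabilityMeasure P ∧ IsPoissonPoints m P A p := by
  choose r π hπ hr using fun k => exists_smul_isProbabilityMeasure (sfiniteSeq m k)
  have h := isPoissonPoints_infinitePi r π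
  have hm : (Measure.sum fun k => r k • π k) = m := by
    simp_rw [← hr]; exact sum_sfiniteSeq m
  rw [hm] at h
  exact ⟨ULift.{u} (ℕ → ℕ × (ℕ → E)), inferInstance, _, _, _,
    Measure.isProbabilityMeasure_map MeasurableEquiv.ulift.symm.measurable.aemeasurable,
    h.comp_measurableEquiv MeasurableEquiv.ulift⟩

end Existence

/-! ### Almost sure properties and characteristic functions of Poisson sums. -/

namespace IsPoissonPoints

variable {Ω E V : Type*} [MeasurableSpace Ω] [MeasurableSpace E] {m : Measure E} {P : Measure Ω}
  {A : ℕ × ℕ → Set Ω} {p : ℕ × ℕ → Ω → E}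

/-- By Campbell's formula the expected number of active points in a null set is zero. -/
lemma ae_forall_of_ae (h : IsPoissonPoints m P A p) {q : E → Prop} (hq : ∀ᵐ x ∂m, q x) :
    ∀ᵐ ω ∂P, ∀ i, ω ∈ A i → q (p i ω) := by
  obtain ⟨s, hs, hsm, hs0⟩ := exists_measurable_superset_of_null (ae_iff.1 hq)
  have h1 := h.campbell (s.indicator 1) (measurable_one.indicator hsm)
  rw [lintegral_indicator_one hsm, hs0] at h1
  have hmeas : Measurable (atomSum A p (s.indicator (1 : E → ℝ≥0∞))) :=
    Measurable.tsum fun i =>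
      ((measurable_one.indicator hsm).comp (h.measurable i)).indicator (h.measurableSet i)
  rw [lintegral_eq_zero_iff hmeas] at h1
  filter_upwards [h1] with ω hω i hi
  by_contra hcon
  have h2 := ENNReal.tsum_eq_zero.1 hω i
  have h3 : p i ω ∈ s := hs hcon
  simp [hi, h3] at h2

variable [NormedAddCommGroup V]

lemma ae_summable_norm [MeasurableSpace V] [BorelSpace V] (h : IsPoissonPoints m P A p) {f : E → V} (hf : Measurable f)
    (hfin : ∫⁻ x, min ‖f x‖ₑ 1 ∂m < ∞) :
    ∀ᵐ ω ∂P, Summable fun i => ‖(A i).indicator (fun ω => f (p i ω)) ω‖ :=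
  ae_summable_norm_of_campbell h.measurableSet h.measurable h.campbell hf hfin

lemma measurable_atomSum [NormedSpace ℝ V] [FiniteDimensional ℝ V] [MeasurableSpace V] [BorelSpace V]
    (h : IsPoissonPoints m P A p) {f : E → V} (hf : Measurable f) :
    Measurable (atomSum A p f) :=
  have := FiniteDimensional.complete ℝ V
  have := FiniteDimensional.proper ℝ V
  ETaS.measurable_atomSum h.measurableSet h.measurable hf

/-- The factor ‖ℓ‖ + 1 dominates both entries of the minimum: the operator norm handles the first,
the 1 handles the truncation level. -/
lemma lintegral_min_clm_lt_top [NormedSpace ℝ V] {f : E → V} (ℓ : StrongDual ℝ V)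
    (hfin : ∫⁻ x, min ‖f x‖ₑ 1 ∂m < ∞) : ∫⁻ x, min ‖ℓ (f x)‖ₑ 1 ∂m < ∞ := by
  have : ∫⁻ x, min ‖ℓ (f x)‖ₑ 1 ∂m ≤ ∫⁻ x, (‖ℓ‖ₑ + 1) * min ‖f x‖ₑ 1 ∂m := by
    refine lintegral_mono fun x => ?_
    rw [mul_min]
    refine min_le_min ?_ ?_
    · exact (ℓ.le_opENorm (f x)).trans (by gcongr; exact le_self_add)
    · rw [mul_one]; exact le_add_self
  refine this.trans_lt ?_
  rw [lintegral_const_mul' _ _ (by simp)]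
  exact ENNReal.mul_lt_top (by simp) hfin

/-- A continuous functional commutes with the sum wherever the sum converges, hence almost surely,
which reduces the vector case to the real characteristic functional. Vector-valued `f` will encode
joint laws. -/
lemma charFunDual_map_atomSum [NormedSpace ℝ V] [FiniteDimensional ℝ V] [MeasurableSpace V] [BorelSpace V]
    (h : IsPoissonPoints m P A p) {f : E → V} (hf : Measurable f)
    (hfin : ∫⁻ x, min ‖f x‖ₑ 1 ∂m < ∞) (ℓ : StrongDual ℝ V) :
    charFunDual (P.map (atomSum A p f)) ℓ =
      Complex.exp (∫ x, (Complex.exp (Complex.I * (ℓ (f x) : ℝ)) - 1) ∂m) := by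
  have := FiniteDimensional.complete ℝ V
  rw [charFunDual_apply, integral_map (h.measurable_atomSum hf).aemeasurable
    (Measurable.aestronglyMeasurable (by fun_prop)),
    ← h.charFunctional (fun x => ℓ (f x)) (by fun_prop) (lintegral_min_clm_lt_top ℓ hfin)]
  refine integral_congr_ae ?_
  filter_upwards [h.ae_summable_norm hf hfin] with ω hω
  rw [mul_comm, atomSum, ℓ.map_tsum hω.of_norm, atomSum]
  congr 4
  ext i
  by_cases hi : ω ∈ A i <;> simp [hi]

end IsPoissonPoints

/-! ### The Lévy measure in logarithmic polar coordinates -/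

section Polar

variable {d : ℕ}

/-- The radial density of the Lévy measure with respect to `d(log r)`. -/
noncomputable def logDensity (α : ℝ) (β : Sphere d → ℝ) (w : Sphere d) (y : ℝ) : ℝ :=
  Real.exp (-(α * y) - β w * Real.exp y)

lemma logDensity_pos (α : ℝ) (β : Sphere d → ℝ) (w : Sphere d) (y : ℝ) :
    0 < logDensity α β w y := Real.exp_pos _

lemma measurable_logDensity (α : ℝ) {β : Sphere d → ℝ} (hβ : Measurable β) :
    Measurable fun p : Sphere d × ℝ => logDensity α β p.1 p.2 := by
  unfold logDensity; fun_prop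

lemma lintegral_Ioi_eq_lintegral_exp (f : ℝ → ℝ≥0∞) :
    ∫⁻ r in Set.Ioi (0 : ℝ), f r = ∫⁻ x, ENNReal.ofReal (Real.exp x) * f (Real.exp x) := by
  have := lintegral_image_eq_lintegral_abs_deriv_mul MeasurableSet.univ
    (fun x _ => (Real.hasDerivAt_exp x).hasDerivWithinAt) Real.exp_injective.injOn f
  rw [Set.image_univ, Real.range_exp] at this
  simpa [abs_of_pos (Real.exp_pos _)] using this

/-- Substitute r = e^x; the Jacobian cancels one power of r. Dilations of space become translations
of x, which preserve Lebesgue measure. -/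
lemma lintegral_levyMeasure (α : ℝ) {β : Sphere d → ℝ} (hβ : Measurable β)
    (lam : Measure (Sphere d)) {k : Space d → ℝ≥0∞} (hk : Measurable k) :
    ∫⁻ y, k y ∂(levyMeasure α β lam) =
      ∫⁻ w, (∫⁻ x, ENNReal.ofReal (logDensity α β w x) * k (Real.exp x • (w : Space d))) ∂lam := by
  have hm : Measurable fun p : Sphere d × ℝ => p.2 • (p.1 : Space d) := by fun_prop
  have hd : Measurable fun p : Sphere d × ℝ =>
      ENNReal.ofReal (Real.exp (-β p.1 * p.2) / p.2 ^ (α + 1)) := by fun_prop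
  have hkm : Measurable fun p : Sphere d × ℝ => k (p.2 • (p.1 : Space d)) := hk.comp hm
  rw [levyMeasure, lintegral_map hk hm,
    lintegral_withDensity_eq_lintegral_mul _ hd hkm,
    lintegral_prod _ (hd.mul hkm).aemeasurable]
  refine lintegral_congr fun w => ?_
  rw [lintegral_Ioi_eq_lintegral_exp]
  refine lintegral_congr fun x => ?_
  simp only [Pi.mul_apply]
  rw [← mul_assoc, ← ENNReal.ofReal_mul (Real.exp_pos x).le]
  congr 2
  rw [logDensity, Real.rpow_def_of_pos (Real.exp_pos x), Real.log_exp, ← Real.exp_sub,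
    ← Real.exp_add]
  ring_nf

instance (α : ℝ) (β : Sphere d → ℝ) (lam : Measure (Sphere d)) [SFinite lam] :
    SFinite (levyMeasure α β lam) := by
  unfold levyMeasure; infer_instance

lemma norm_exp_smul (x : ℝ) (w : Sphere d) : ‖Real.exp x • (w : Space d)‖ = Real.exp x := by
  rw [norm_smul, norm_eq_of_mem_sphere]; simp

end Polar

/-! ### The characteristic function of the Cauchy law -/

section Cauchy

open FourierTransform Complex

lemma exp_mul_exp_neg_abs_of_nonneg {b x : ℝ} (hx : 0 ≤ x) :
    cexp ((b * x : ℝ) * I) * (Real.exp (-|x|) : ℝ) = cexp ((-1 + b * I) * x) := by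
  rw [abs_of_nonneg hx, Complex.ofReal_exp, ← Complex.exp_add]
  congr 1; push_cast; ring

lemma exp_mul_exp_neg_abs_of_nonpos {b x : ℝ} (hx : x ≤ 0) :
    cexp ((b * x : ℝ) * I) * (Real.exp (-|x|) : ℝ) = cexp ((1 + b * I) * x) := by
  rw [abs_of_nonpos hx, Complex.ofReal_exp, ← Complex.exp_add]
  congr 1; push_cast; ring

lemma integrableOn_exp_mul_exp_neg_abs (b : ℝ) :
    IntegrableOn (fun x : ℝ => cexp ((b * x : ℝ) * I) * (Real.exp (-|x|) : ℝ)) (Set.Iic 0) ∧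
    IntegrableOn (fun x : ℝ => cexp ((b * x : ℝ) * I) * (Real.exp (-|x|) : ℝ)) (Set.Ioi 0) :=
  ⟨(integrableOn_exp_mul_complex_Iic (a := 1 + b * I) (by simp) 0).congr_fun
      (fun _ hx => (exp_mul_exp_neg_abs_of_nonpos hx).symm) measurableSet_Iic,
    (integrableOn_exp_mul_complex_Ioi (a := -1 + b * I) (by simp) 0).congr_fun
      (fun _ hx => (exp_mul_exp_neg_abs_of_nonneg (le_of_lt hx)).symm) measurableSet_Ioi⟩

lemma integral_exp_mul_exp_neg_abs (b : ℝ) :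
    ∫ x : ℝ, cexp ((b * x : ℝ) * I) * (Real.exp (-|x|) : ℝ) = (2 / (1 + b ^ 2) : ℝ) := by
  obtain ⟨h1, h2⟩ := integrableOn_exp_mul_exp_neg_abs b
  rw [← intervalIntegral.integral_Iic_add_Ioi h1 h2,
    setIntegral_congr_fun measurableSet_Iic fun x hx => exp_mul_exp_neg_abs_of_nonpos hx,
    setIntegral_congr_fun measurableSet_Ioi fun x hx => exp_mul_exp_neg_abs_of_nonneg (le_of_lt hx),
    integral_exp_mul_complex_Iic (by simp), integral_exp_mul_complex_Ioi (by simp)]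
  have hb : (1 + (b : ℂ) ^ 2) ≠ 0 := by
    have : (1 + b ^ 2 : ℝ) ≠ 0 := by positivity
    exact_mod_cast this
  have e1 : (1 + (b : ℂ) * I) ≠ 0 := fun h => by simpa using congrArg Complex.re h
  have e2 : (-1 + (b : ℂ) * I) ≠ 0 := fun h => by simpa using congrArg Complex.re h
  simp only [ofReal_zero, mul_zero, Complex.exp_zero]
  push_cast
  field_simp
  linear_combination (-2 * (b : ℂ) ^ 2) * I_sq

lemma integrable_exp_neg_abs : Integrable fun x : ℝ => ((Real.exp (-|x|) : ℝ) : ℂ) := by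
  obtain ⟨h1, h2⟩ := integrableOn_exp_mul_exp_neg_abs 0
  have := h1.union h2
  rw [Set.Iic_union_Ioi, integrableOn_univ] at this
  simpa using this

lemma fourier_exp_neg_abs (ξ : ℝ) :
    𝓕 (fun x : ℝ => ((Real.exp (-|x|) : ℝ) : ℂ)) ξ = (2 / (1 + (-2 * Real.pi * ξ) ^ 2) : ℝ) := by
  rw [Real.fourier_eq', ← integral_exp_mul_exp_neg_abs]
  refine integral_congr_ae (ae_of_all _ fun x => ?_)
  simp only [smul_eq_mul, RCLike.inner_apply, conj_trivial]
  congr 4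
  ring

/-- Fourier inversion: the transform of e^{-|x|} is elementary and is, after the rescaling s = 2πξ,
the Cauchy density up to a constant. -/
lemma integral_exp_cauchyMeasure (x : ℝ) :
    ∫ s, cexp (I * (s * x : ℝ)) ∂(cauchyMeasure 0 1) = Real.exp (-|x|) := by
  have hF : 𝓕 (fun x : ℝ => ((Real.exp (-|x|) : ℝ) : ℂ)) =
      fun ξ : ℝ => ((2 / (1 + (-2 * Real.pi * ξ) ^ 2) : ℝ) : ℂ) := funext fourier_exp_neg_abs
  have hpi : (-2 * Real.pi) ≠ 0 := by simp [Real.pi_ne_zero]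
  have hint : Integrable (𝓕 (fun x : ℝ => ((Real.exp (-|x|) : ℝ) : ℂ))) := by
    rw [hF]
    refine Integrable.ofReal (((integrable_inv_one_add_sq.comp_mul_left' hpi).const_mul 2).congr
      (ae_of_all _ fun ξ => ?_))
    exact (div_eq_mul_inv _ _).symm
  have hinv := congrFun (Continuous.fourierInv_fourier_eq (by fun_prop) integrable_exp_neg_abs
    hint) x
  rw [hF, Real.fourierInv_eq'] at hinv
  have hpdf : Measurable (cauchyPDF 0 1) := measurable_cauchyPDF 0 1
  rw [← hinv, cauchyMeasure_of_scale_ne_zero _ one_ne_zero,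
    integral_withDensity_eq_integral_toReal_smul hpdf
      (ae_of_all _ fun _ => ENNReal.ofReal_lt_top)]
  have hpi' : 0 < 2 * Real.pi := by positivity
  have hc := Measure.integral_comp_mul_left (fun s : ℝ =>
    (cauchyPDF 0 1 s).toReal • cexp (I * (s * x : ℝ))) (2 * Real.pi)
  rw [abs_of_pos (inv_pos.2 hpi'), eq_inv_smul_iff₀ hpi'.ne', ← integral_smul] at hc
  rw [← hc]
  refine integral_congr_ae (ae_of_all _ fun s => ?_)
  simp only
  rw [cauchyPDF, ENNReal.toReal_ofReal (cauchyPDF_pos 0 one_ne_zero _).le, cauchyPDFReal,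
    smul_smul, smul_eq_mul, mul_comm (cexp _), ← Complex.real_smul]
  congr 1
  · simp
    field_simp
    ring
  · congr 1
    simp only [RCLike.inner_apply, conj_trivial]
    push_cast
    ring

end Cauchy

/-! ### Jumps as points below an increasing family of graphs. -/

section Jump

variable {d : ℕ} {α q : ℝ} {β : Sphere d → ℝ}

/-- The density, with respect to `d(log r)`, of the Lévy measure of the Sato process at time `t`. -/
noncomputable def level (α q : ℝ) (β : Sphere d → ℝ) (t : ℝ≥0) (p : Sphere d × ℝ) : ℝ :=
  if t = 0 then 0 else logDensity α β p.1 (p.2 - q * Real.log t)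

/-- The points below the graph of `level` at time `t`: those which have jumped by time `t`. -/
def jumped (α q : ℝ) (β : Sphere d → ℝ) (t : ℝ≥0) : Set ((Sphere d × ℝ) × ℝ) :=
  {e | 0 < e.2 ∧ e.2 ≤ level α q β t e.1}

/-- The contribution at time `t` of the point `((w, x), u)`: the jump `e^x w`, if it has occurred. -/
noncomputable def jump (α q : ℝ) (β : Sphere d → ℝ) (t : ℝ≥0) : (Sphere d × ℝ) × ℝ → Space d :=
  (jumped α q β t).indicator fun e => Real.exp e.1.2 • (e.1.1 : Space d)

/-- The intensity of the point process of jumps. -/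
noncomputable def jumpIntensity (lam : Measure (Sphere d)) : Measure ((Sphere d × ℝ) × ℝ) :=
  (lam.prod volume).prod volume

/-- This is the self-decomposability of the law: it makes the time-t densities increase with t, so
that a point which has jumped stays jumped. -/
lemma logDensity_strictAnti (hα : 0 < α) (hβ : ∀ w, 0 < β w) (w : Sphere d) :
    StrictAnti (logDensity α β w) := fun x y hxy => by
  unfold logDensity
  have h1 : α * x < α * y := by gcongr
  have h2 : β w * Real.exp x < β w * Real.exp y := by have := hβ w; gcongr
  exact Real.exp_lt_exp.2 (by linarith)

lemma continuous_logDensity (w : Sphere d) : Continuous (logDensity α β w) := by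
  unfold logDensity; fun_prop

lemma logDensity_le (hβ : ∀ w, 0 < β w) (w : Sphere d) (y : ℝ) :
    logDensity α β w y ≤ Real.exp (-(α * y)) := by
  unfold logDensity
  have := mul_pos (hβ w) (Real.exp_pos y)
  exact Real.exp_le_exp.2 (by linarith)

lemma level_nonneg (t : ℝ≥0) (p : Sphere d × ℝ) : 0 ≤ level α q β t p := by
  unfold level; split_ifs
  · exact le_rfl
  · exact (logDensity_pos _ _ _ _).le

lemma level_mono (hα : 0 < α) (hq : 0 < q) (hβ : ∀ w, 0 < β w) (p : Sphere d × ℝ) :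
    Monotone fun t => level α q β t p := by
  intro s t hst
  by_cases hs : s = 0
  · simpa [level, hs] using level_nonneg t p
  · have ht : t ≠ 0 := fun h => hs (le_antisymm (h ▸ hst) zero_le)
    simp only [level, hs, ht, if_false]
    refine (logDensity_strictAnti hα hβ p.1).antitone ?_
    have : Real.log s ≤ Real.log t :=
      Real.log_le_log (by exact_mod_cast pos_iff_ne_zero.2 hs) (by exact_mod_cast hst)
    gcongr

lemma tendsto_logDensity_atTop (hα : 0 < α) (hβ : ∀ w, 0 < β w) (w : Sphere d) :
    Tendsto (logDensity α β w) atTop (𝓝 0) := by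
  refine squeeze_zero (fun y => (logDensity_pos α β w y).le) (fun y => logDensity_le hβ w y) ?_
  exact Real.tendsto_exp_neg_atTop_nhds_zero.comp (tendsto_id.const_mul_atTop hα)

lemma continuous_level (hα : 0 < α) (hq : 0 < q) (hβ : ∀ w, 0 < β w) (p : Sphere d × ℝ) :
    Continuous fun t => level α q β t p := by
  refine continuous_iff_continuousAt.2 fun t => ?_
  by_cases ht : t = 0
  · subst ht
    rw [ContinuousAt, ← pure_sup_nhdsNE, tendsto_sup]
    refine ⟨tendsto_pure_nhds _ _, ?_⟩
    have h0 : level α q β 0 p = 0 := by simp [level]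
    rw [h0]
    -- As t tends to 0 the argument x - q log t tends to +∞, where the density vanishes; this
    -- matches the value 0 assigned to `level` at t = 0.
    have h1 : Tendsto (fun t : ℝ≥0 => p.2 - q * Real.log t) (𝓝[≠] 0) atTop := by
      have hlog : Tendsto (fun t : ℝ≥0 => Real.log t) (𝓝[≠] 0) atBot := by
        refine Real.tendsto_log_nhdsNE_zero.comp ?_
        refine tendsto_nhdsWithin_iff.2 ⟨?_, ?_⟩
        · exact (NNReal.continuous_coe.tendsto' 0 0 rfl).mono_left nhdsWithin_le_nhds
        · filter_upwards [self_mem_nhdsWithin] with t ht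
          simpa using ht
      simp only [sub_eq_add_neg]
      refine tendsto_atTop_add_const_left _ _ (tendsto_neg_atBot_atTop.comp ?_)
      exact hlog.const_mul_atBot hq
    refine ((tendsto_logDensity_atTop hα hβ p.1).comp h1).congr' ?_
    filter_upwards [self_mem_nhdsWithin] with t ht
    have : t ≠ 0 := ht
    simp [level, this]
  · have h1 : ContinuousAt (fun t : ℝ≥0 => logDensity α β p.1 (p.2 - q * Real.log t)) t := by
      refine (continuous_logDensity p.1).continuousAt.comp ?_
      refine continuousAt_const.sub (continuousAt_const.mul ?_)
      exact (Real.continuousAt_log (by exact_mod_cast ht)).comp NNReal.continuous_coe.continuousAt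
    refine h1.congr ?_
    filter_upwards [isOpen_ne.mem_nhds ht] with s hs
    have : s ≠ 0 := hs
    simp [level, this]

lemma measurable_level (hβ : Measurable β) (t : ℝ≥0) : Measurable (level α q β t) := by
  unfold level
  by_cases ht : t = 0
  · simp [ht]
  · simp only [ht, if_false]
    unfold logDensity; fun_prop

lemma measurableSet_jumped (hβ : Measurable β) (t : ℝ≥0) : MeasurableSet (jumped α q β t) :=
  (measurableSet_lt measurable_const measurable_snd).inter
    (measurableSet_le measurable_snd ((measurable_level hβ t).comp measurable_fst))

lemma measurable_jump (hβ : Measurable β) (t : ℝ≥0) : Measurable (jump α q β t) :=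
  Measurable.indicator (by fun_prop) (measurableSet_jumped hβ t)

lemma jumped_mono (hα : 0 < α) (hq : 0 < q) (hβ : ∀ w, 0 < β w) : Monotone (jumped α q β) :=
  fun _ _ hst e he => ⟨he.1, he.2.trans (level_mono hα hq hβ e.1 hst)⟩

lemma norm_jump_mono (hα : 0 < α) (hq : 0 < q) (hβ : ∀ w, 0 < β w) (e : (Sphere d × ℝ) × ℝ) :
    Monotone fun t => ‖jump α q β t e‖ := fun s t hst => by
  simp only [jump]
  exact norm_indicator_le_of_subset (jumped_mono hα hq hβ hst) _ _

lemma jump_mono_of_nonneg (hα : 0 < α) (hq : 0 < q) (hβ : ∀ w, 0 < β w)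
    {e : (Sphere d × ℝ) × ℝ} (he : e.1.1 ∈ positiveSphere d) (i : Fin d) :
    Monotone fun t => jump α q β t e i := fun s t hst => by
  have h0 : 0 ≤ Real.exp e.1.2 * (e.1.1 : Space d) i := mul_nonneg (Real.exp_pos _).le (he i)
  by_cases hs : e ∈ jumped α q β s
  · have ht := jumped_mono hα hq hβ hst hs
    simp [jump, hs, ht]
  · by_cases ht : e ∈ jumped α q β t <;> simp [jump, hs, ht, h0]

lemma jump_zero (e : (Sphere d × ℝ) × ℝ) : jump α q β 0 e = 0 := by
  refine Set.indicator_of_notMem (fun h => ?_) _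
  have h1 := h.2
  simp only [level, if_true] at h1
  exact absurd h.1 (not_lt.2 h1)

lemma jump_congr {e : (Sphere d × ℝ) × ℝ} {s t : ℝ≥0}
    (h : e ∈ jumped α q β s ↔ e ∈ jumped α q β t) : jump α q β s e = jump α q β t e := by
  by_cases hs : e ∈ jumped α q β s
  · simp [jump, hs, h.1 hs]
  · simp [jump, hs, mt h.2 hs]

lemma tendsto_jump_of_ne (hα : 0 < α) (hq : 0 < q) (hβ : ∀ w, 0 < β w)
    {e : (Sphere d × ℝ) × ℝ} {t : ℝ≥0} (he : e.2 ≠ level α q β t e.1) :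
    Tendsto (fun s => jump α q β s e) (𝓝 t) (𝓝 (jump α q β t e)) := by
  have hc := (continuous_level hα hq hβ e.1).continuousAt (x := t)
  refine tendsto_nhds_of_eventually_eq ?_
  rcases lt_or_gt_of_ne he with h | h
  · filter_upwards [hc.eventually (lt_mem_nhds h)] with s hs
    have : e ∈ jumped α q β s ↔ e ∈ jumped α q β t :=
      ⟨fun h' => ⟨h'.1, h.le⟩, fun h' => ⟨h'.1, le_of_lt hs⟩⟩
    exact jump_congr this
  · filter_upwards [hc.eventually (gt_mem_nhds h)] with s hs
    have h1 : e ∉ jumped α q β s := fun h' => absurd h'.2 (not_le.2 hs)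
    have h2 : e ∉ jumped α q β t := fun h' => absurd h'.2 (not_le.2 h)
    simp [jump, h1, h2]

/-- The only critical case is a point lying exactly on the graph at time t. The non-strict
inequality in `jumped` counts it as jumped at t, and monotonicity keeps it so afterwards. -/
lemma continuousWithinAt_jump (hα : 0 < α) (hq : 0 < q) (hβ : ∀ w, 0 < β w)
    (e : (Sphere d × ℝ) × ℝ) (t : ℝ≥0) :
    ContinuousWithinAt (fun s => jump α q β s e) (Set.Ici t) t := by
  by_cases he : e.2 = level α q β t e.1
  · refine tendsto_nhds_of_eventually_eq ?_
    filter_upwards [self_mem_nhdsWithin] with s hs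
    have : e ∈ jumped α q β s ↔ e ∈ jumped α q β t :=
      ⟨fun h' => ⟨h'.1, he.le⟩, fun h' => jumped_mono hα hq hβ hs h'⟩
    exact jump_congr this
  · exact (tendsto_jump_of_ne hα hq hβ he).mono_left nhdsWithin_le_nhds

lemma exists_tendsto_jump_left (hα : 0 < α) (hq : 0 < q) (hβ : ∀ w, 0 < β w)
    (e : (Sphere d × ℝ) × ℝ) (t : ℝ≥0) :
    ∃ l, Tendsto (fun s => jump α q β s e) (𝓝[<] t) (𝓝 l) := by
  by_cases h : ∃ s < t, e ∈ jumped α q β s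
  · obtain ⟨s, hst, hs⟩ := h
    refine ⟨Real.exp e.1.2 • (e.1.1 : Space d), tendsto_nhds_of_eventually_eq ?_⟩
    filter_upwards [Ioo_mem_nhdsLT hst] with r hr
    exact Set.indicator_of_mem (jumped_mono hα hq hβ hr.1.le hs) _
  · push Not at h
    refine ⟨0, tendsto_nhds_of_eventually_eq ?_⟩
    filter_upwards [self_mem_nhdsWithin] with r hr
    exact Set.indicator_of_notMem (h r hr) _

/-- The translation of the logarithmic radius that corresponds to a change of time scale. -/
noncomputable def scaleEquiv (d : ℕ) (c : ℝ) :
    (Sphere d × ℝ) × ℝ ≃ᵐ (Sphere d × ℝ) × ℝ :=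
  ((MeasurableEquiv.refl _).prodCongr (MeasurableEquiv.addRight c)).prodCongr
    (MeasurableEquiv.refl _)

lemma measurePreserving_scaleEquiv (lam : Measure (Sphere d)) [SFinite lam] (c : ℝ) :
    MeasurePreserving (scaleEquiv d c) (jumpIntensity lam) (jumpIntensity lam) :=
  ((MeasurePreserving.id lam).prod (measurePreserving_add_right volume c)).prod
    (MeasurePreserving.id volume)

/-- Shifting x by q log a offsets the shift of the level between times t and at, and multiplies e^x
by a^q. This is self-similarity at the level of a single point. -/
lemma jump_scaleEquiv {a : ℝ≥0} (ha : 0 < a) (t : ℝ≥0) (e : (Sphere d × ℝ) × ℝ) :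
    jump α q β (a * t) (scaleEquiv d (q * Real.log a) e) = (a : ℝ) ^ q • jump α q β t e := by
  have hl : level α q β (a * t) (scaleEquiv d (q * Real.log a) e).1 = level α q β t e.1 := by
    by_cases ht : t = 0
    · simp [level, ht]
    · simp only [level, mul_eq_zero, ha.ne', ht, or_self, if_false, NNReal.coe_mul]
      rw [Real.log_mul (by exact_mod_cast ha.ne') (by exact_mod_cast ht)]
      simp only [scaleEquiv, MeasurableEquiv.prodCongr, MeasurableEquiv.addRight]
      simp
      congr 1; ring
  have hmem : scaleEquiv d (q * Real.log a) e ∈ jumped α q β (a * t) ↔ e ∈ jumped α q β t := by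
    simp only [jumped, Set.mem_ofPred_eq, hl]
    rfl
  by_cases he : e ∈ jumped α q β t
  · rw [jump, jump, Set.indicator_of_mem (hmem.2 he), Set.indicator_of_mem he, smul_smul,
      Real.rpow_def_of_pos (by exact_mod_cast ha), ← Real.exp_add]
    have h1 : (scaleEquiv d (q * Real.log a) e).1.2 = e.1.2 + q * Real.log a := rfl
    have h2 : (scaleEquiv d (q * Real.log a) e).1.1 = e.1.1 := rfl
    rw [h1, h2]
    congr 2; ring
  · rw [jump, jump, Set.indicator_of_notMem (fun h => he (hmem.1 h)),
      Set.indicator_of_notMem he, smul_zero]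

variable {lam : Measure (Sphere d)}

/-- A graph has measure zero, so almost surely no point jumps exactly at a prescribed time;
stochastic continuity rests on this. -/
lemma ae_snd_ne_level (hβ : Measurable β) (t : ℝ≥0) :
    ∀ᵐ e ∂(jumpIntensity lam), e.2 ≠ level α q β t e.1 := by
  have hS : MeasurableSet {e : (Sphere d × ℝ) × ℝ | e.2 = level α q β t e.1} :=
    measurableSet_eq_fun measurable_snd ((measurable_level hβ t).comp measurable_fst)
  rw [ae_iff]
  simp only [not_not]
  rw [jumpIntensity, Measure.measure_prod_null hS]
  refine ae_of_all _ fun p => ?_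
  have : Prod.mk p ⁻¹' {e : (Sphere d × ℝ) × ℝ | e.2 = level α q β t e.1} =
    {level α q β t p} := by ext; simp
  simp [this]

lemma ae_mem_of_compl_null {s : Set (Sphere d)} (hs : lam sᶜ = 0) :
    ∀ᵐ e ∂(jumpIntensity lam), e.1.1 ∈ s := by
  have h1 : ∀ᵐ w ∂lam, w ∈ s := hs
  exact Measure.quasiMeasurePreserving_fst.ae (Measure.quasiMeasurePreserving_fst.ae h1)

/-- Integrating out u over (0, `level`] restores the density. At t = 1 the shift q log t vanishes,
so the level is `logDensity` itself. -/
lemma map_restrict_jumped_one [SFinite lam] (hβ : Measurable β) :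
    ((jumpIntensity lam).restrict (jumped α q β 1)).map
      (fun e => Real.exp e.1.2 • (e.1.1 : Space d)) = levyMeasure α β lam := by
  have hm : Measurable fun p : Sphere d × ℝ => Real.exp p.2 • (p.1 : Space d) := by fun_prop
  refine Measure.ext_of_lintegral _ fun k hk => ?_
  have hlev : Measurable fun p : Sphere d × ℝ => ENNReal.ofReal (level α q β 1 p) :=
    (measurable_level hβ 1).ennreal_ofReal
  rw [lintegral_map hk (by fun_prop), ← lintegral_indicator (measurableSet_jumped hβ 1),
    jumpIntensity, lintegral_prod, lintegral_levyMeasure α hβ _ hk]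
  swap
  · exact (Measurable.indicator (by fun_prop) (measurableSet_jumped hβ 1)).aemeasurable
  have h1 : ∀ p : Sphere d × ℝ, ∫⁻ u, (jumped α q β 1).indicator
      (fun e => k (Real.exp e.1.2 • (e.1.1 : Space d))) (p, u) =
      ENNReal.ofReal (level α q β 1 p) * k (Real.exp p.2 • (p.1 : Space d)) := by
    intro p
    have h2 : ∀ u, (jumped α q β 1).indicator
        (fun e => k (Real.exp e.1.2 • (e.1.1 : Space d))) (p, u) =
        (Set.Ioc 0 (level α q β 1 p)).indicator
          (fun _ => k (Real.exp p.2 • (p.1 : Space d))) u := fun u => by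
      by_cases hu : 0 < u ∧ u ≤ level α q β 1 p
      · rw [Set.indicator_of_mem (show (p, u) ∈ jumped α q β 1 from hu),
          Set.indicator_of_mem (show u ∈ Set.Ioc 0 (level α q β 1 p) from hu)]
      · rw [Set.indicator_of_notMem (show (p, u) ∉ jumped α q β 1 from hu),
          Set.indicator_of_notMem (show u ∉ Set.Ioc 0 (level α q β 1 p) from hu)]
    simp_rw [h2]
    rw [lintegral_indicator measurableSet_Ioc, setLIntegral_const, Real.volume_Ioc, sub_zero,
      mul_comm]
  simp_rw [h1]
  have hkm : Measurable fun p : Sphere d × ℝ =>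
      ENNReal.ofReal (level α q β 1 p) * k (Real.exp p.2 • (p.1 : Space d)) :=
    hlev.mul (hk.comp hm)
  rw [lintegral_prod _ hkm.aemeasurable]
  simp [level]

lemma lintegral_comp_jump_one [SFinite lam] (hβ : Measurable β) {k : Space d → ℝ≥0∞} (hk : Measurable k)
    (h0 : k 0 = 0) :
    ∫⁻ e, k (jump α q β 1 e) ∂(jumpIntensity lam) = ∫⁻ y, k y ∂(levyMeasure α β lam) := by
  rw [← map_restrict_jumped_one (q := q) hβ, lintegral_map hk (by fun_prop),
    ← lintegral_indicator (measurableSet_jumped hβ 1)]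
  refine lintegral_congr fun e => ?_
  by_cases he : e ∈ jumped α q β 1 <;> simp [jump, he, h0]

lemma integral_comp_jump_one [SFinite lam] (hβ : Measurable β) {k : Space d → ℂ} (hk : Measurable k)
    (h0 : k 0 = 0) :
    ∫ e, k (jump α q β 1 e) ∂(jumpIntensity lam) = ∫ y, k y ∂(levyMeasure α β lam) := by
  have hm : Measurable fun e : (Sphere d × ℝ) × ℝ => Real.exp e.1.2 • (e.1.1 : Space d) := by
    fun_prop
  rw [← map_restrict_jumped_one (q := q) hβ, integral_map hm.aemeasurable
    hk.aestronglyMeasurable, ← integral_indicator (measurableSet_jumped hβ 1)]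
  refine integral_congr_ae (ae_of_all _ fun e => ?_)
  by_cases he : e ∈ jumped α q β 1 <;> simp [jump, he, h0]

/-- α < 1 gives convergence at -∞ (integrand e^{(1-α)x}) and α > 0 at +∞ (integrand e^{-αx}). No
tempering is used, so the resulting bound on `ν` is uniform in w without a lower bound on β. -/
lemma lintegral_min_exp_lt_top (hα : α ∈ Set.Ioo (0 : ℝ) 1) :
    ∫⁻ x : ℝ, ENNReal.ofReal (Real.exp (-(α * x))) * min (ENNReal.ofReal (Real.exp x)) 1 < ∞ := by
  have h1 : IntegrableOn (fun x : ℝ => Real.exp ((1 - α) * x)) (Set.Iic 0) :=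
    integrableOn_exp_mul_Iic (by linarith [hα.2]) 0
  have h2 : IntegrableOn (fun x : ℝ => Real.exp (-α * x)) (Set.Ioi 0) :=
    integrableOn_exp_mul_Ioi (by linarith [hα.1]) 0
  rw [← lintegral_add_compl _ (measurableSet_Iic (a := (0 : ℝ))), Set.compl_Iic]
  refine ENNReal.add_lt_top.2 ⟨?_, ?_⟩
  · refine lt_of_le_of_lt (lintegral_mono fun x => ?_) h1.hasFiniteIntegral
    rw [Real.enorm_eq_ofReal (Real.exp_pos _).le]
    refine (mul_le_mul_right (min_le_left _ _) _).trans ?_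
    rw [← ENNReal.ofReal_mul (Real.exp_pos _).le, ← Real.exp_add]
    refine le_of_eq ?_
    congr 2; ring
  · refine lt_of_le_of_lt (lintegral_mono fun x => ?_) h2.hasFiniteIntegral
    rw [Real.enorm_eq_ofReal (Real.exp_pos _).le]
    refine (mul_le_mul_right (min_le_right _ _) _).trans ?_
    rw [mul_one, neg_mul]

lemma lintegral_min_norm_levyMeasure_lt_top {lam : Measure (Sphere d)} [IsFiniteMeasure lam]
    (hα : α ∈ Set.Ioo (0 : ℝ) 1) (hβm : Measurable β) (hβ : ∀ w, 0 < β w) :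
    ∫⁻ y, min ‖y‖ₑ 1 ∂(levyMeasure α β lam) < ∞ := by
  rw [lintegral_levyMeasure α hβm _ (by fun_prop)]
  refine lt_of_le_of_lt (lintegral_mono fun w => (lintegral_mono fun x => ?_ :
    _ ≤ ∫⁻ x : ℝ, ENNReal.ofReal (Real.exp (-(α * x))) * min (ENNReal.ofReal (Real.exp x)) 1)) ?_
  · rw [← ofReal_norm, norm_exp_smul]
    gcongr
    exact logDensity_le hβ w x
  · rw [lintegral_const]
    exact ENNReal.mul_lt_top (lintegral_min_exp_lt_top hα) (measure_lt_top _ _)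

lemma lintegral_min_norm_jump_lt_top {lam : Measure (Sphere d)} [IsFiniteMeasure lam]
    (hα : α ∈ Set.Ioo (0 : ℝ) 1) (hβm : Measurable β) (hβ : ∀ w, 0 < β w) (t : ℝ≥0) :
    ∫⁻ e, min ‖jump α q β t e‖ₑ 1 ∂(jumpIntensity lam) < ∞ := by
  by_cases ht : t = 0
  · simp [ht, jump_zero]
  have h1 := lintegral_min_norm_levyMeasure_lt_top (lam := lam) hα hβm hβ
  rw [← lintegral_comp_jump_one (q := q) hβm (by fun_prop) (by simp)] at h1
  have ht' : 0 < t := pos_iff_ne_zero.2 ht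
  -- Scaling reduces time t to time 1, at the price of the factor t^q.
  rw [← (measurePreserving_scaleEquiv lam (q * Real.log t)).lintegral_comp
    ((measurable_jump hβm t).enorm.min measurable_const)]
  set c := ‖(t : ℝ) ^ q‖ₑ
  refine lt_of_le_of_lt (lintegral_mono fun e => ?_ :
    _ ≤ ∫⁻ e, (c + 1) * min ‖jump α q β 1 e‖ₑ 1 ∂(jumpIntensity lam)) ?_
  · have := jump_scaleEquiv (α := α) (q := q) (β := β) ht' 1 e
    rw [mul_one] at this
    simp only
    rw [this, enorm_smul, mul_min]
    refine min_le_min ?_ ?_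
    · gcongr; exact le_self_add
    · rw [mul_one]; exact le_add_self
  · rw [lintegral_const_mul' _ _ (by simp [c])]
    exact ENNReal.mul_lt_top (by simp [c]) h1

end Jump

/-! ### Driftless infinitely divisible laws -/

section Laws

variable {d : ℕ} {ν : Measure (Space d)} {μ : Measure (Space d)}

theorem exists_charFun_eq (ν : Measure (Space d)) [SFinite ν] (hν : ∫⁻ y, min ‖y‖ₑ 1 ∂ν < ∞) :
    ∃ μ : Measure (Space d), IsProbabilityMeasure μ ∧ ∀ z : Space d, charFun μ z =
      Complex.exp (∫ x, (Complex.exp (Complex.I * (⟪z, x⟫ : ℝ)) - 1) ∂ν) := by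
  obtain ⟨Ω, _, P, A, p, hP, h⟩ := exists_isPoissonPoints.{0} ν
  refine ⟨P.map (atomSum A p id), Measure.isProbabilityMeasure_map
    (h.measurable_atomSum measurable_id).aemeasurable, fun z => ?_⟩
  rw [charFun_eq_charFunDual_toDualMap, h.charFunDual_map_atomSum measurable_id hν]
  simp

/-- The n-th convolution root is the driftless law with Lévy measure ν/n. -/
lemma isInfinitelyDivisible_of_charFun [SFinite ν] (hν : ∫⁻ y, min ‖y‖ₑ 1 ∂ν < ∞)
    [IsProbabilityMeasure μ] (h : ∀ z : Space d, charFun μ z =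
      Complex.exp (∫ x, (Complex.exp (Complex.I * (⟪z, x⟫ : ℝ)) - 1) ∂ν)) :
    IsInfinitelyDivisible μ := by
  intro n hn
  have hfin : ∫⁻ y, min ‖y‖ₑ 1 ∂((n : ℝ≥0)⁻¹ • ν) < ∞ := by
    rw [lintegral_smul_measure]
    exact ENNReal.mul_lt_top (by simp) hν
  obtain ⟨ρ, hρ, hc⟩ := exists_charFun_eq ((n : ℝ≥0)⁻¹ • ν) hfin
  refine ⟨ρ, hρ, ?_⟩
  have : IsProbabilityMeasure ((Measure.pi (fun _ : Fin n => ρ)).map (fun x => ∑ i, x i)) :=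
    Measure.isProbabilityMeasure_map (by fun_prop)
  refine Measure.ext_of_charFun ?_
  ext z
  rw [charFun_map_sum_pi_eq_prod, Finset.prod_apply]
  simp only [hc, h, Finset.prod_const, Finset.card_univ, Fintype.card_fin]
  rw [← Complex.exp_nat_mul, integral_smul_nnreal_measure]
  congr 1
  have : (n : ℂ) ≠ 0 := by exact_mod_cast (by omega : n ≠ 0)
  rw [NNReal.smul_def, Complex.real_smul]
  push_cast
  field_simp

lemma integrable_exp_inner_sub_one (hν : ∫⁻ y, min ‖y‖ₑ 1 ∂ν < ∞) (z : Space d) :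
    Integrable (fun x => Complex.exp (Complex.I * (⟪z, x⟫ : ℝ)) - 1) ν :=
  integrable_exp_sub_one (by fun_prop)
    (IsPoissonPoints.lintegral_min_clm_lt_top (f := id) (InnerProductSpace.toDualMap ℝ _ z) hν)

lemma integrableOn_closedBall (hν : ∫⁻ y, min ‖y‖ₑ 1 ∂ν < ∞) :
    IntegrableOn (fun x : Space d => x) (Metric.closedBall 0 1) ν := by
  refine ⟨aestronglyMeasurable_id, lt_of_le_of_lt ?_ hν⟩
  refine (setLIntegral_mono_ae (g := fun y => min ‖y‖ₑ 1) (by fun_prop)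
    (ae_of_all _ fun x hx => le_min le_rfl ?_)).trans (setLIntegral_le_lintegral _ _)
  rw [← ofReal_norm]
  exact ENNReal.ofReal_le_one.2 (by simpa using hx)

lemma isLevyMeasure_of_lintegral_min (hν : ∫⁻ y, min ‖y‖ₑ 1 ∂ν < ∞) (h0 : ν {0} = 0) :
    IsLevyMeasure ν := by
  refine ⟨h0, lt_of_le_of_lt (lintegral_mono fun x => ?_) hν⟩
  refine le_min ?_ ?_
  · rw [← ofReal_norm]
    refine ENNReal.ofReal_le_ofReal ?_
    rcases le_total ‖x‖ 1 with h | h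
    · exact (min_le_left _ _).trans (by nlinarith [norm_nonneg x])
    · exact (min_le_right _ _).trans h
  · exact ENNReal.ofReal_le_one.2 (min_le_right _ _)

lemma integral_levyKhintchine_eq (hν : ∫⁻ y, min ‖y‖ₑ 1 ∂ν < ∞) (z : Space d) :
    ∫ x, (Complex.exp (Complex.I * (⟪z, x⟫ : ℝ)) - 1 -
      (Metric.closedBall (0 : Space d) 1).indicator (fun y => Complex.I * (⟪z, y⟫ : ℝ)) x) ∂ν =
    ∫ x, (Complex.exp (Complex.I * (⟪z, x⟫ : ℝ)) - 1) ∂ν -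
      Complex.I * (⟪∫ x in Metric.closedBall (0 : Space d) 1, x ∂ν, z⟫ : ℝ) := by
  have hi := integrableOn_closedBall hν
  have h1 : IntegrableOn (fun x : Space d => Complex.I * (⟪z, x⟫ : ℝ)) (Metric.closedBall 0 1) ν :=
    (hi.const_inner z).ofReal.const_mul _
  rw [integral_sub (integrable_exp_inner_sub_one hν z)
    ((integrable_indicator_iff Metric.isClosed_closedBall.measurableSet).2 h1),
    integral_indicator Metric.isClosed_closedBall.measurableSet, integral_const_mul,
    integral_complex_ofReal, integral_inner hi z, real_inner_comm]

lemma hasLevyKhintchine_of_charFun (hν : ∫⁻ y, min ‖y‖ₑ 1 ∂ν < ∞) (h0 : ν {0} = 0)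
    (h : ∀ z : Space d, charFun μ z =
      Complex.exp (∫ x, (Complex.exp (Complex.I * (⟪z, x⟫ : ℝ)) - 1) ∂ν)) :
    HasLevyKhintchine μ (∫ x in Metric.closedBall (0 : Space d) 1, x ∂ν) ν := by
  refine ⟨isLevyMeasure_of_lintegral_min hν h0, fun z => ?_⟩
  rw [h, integral_levyKhintchine_eq hν]
  congr 1; ring

lemma levyMeasure_singleton_zero (α : ℝ) {β : Sphere d → ℝ} (hβ : Measurable β)
    (lam : Measure (Sphere d)) : levyMeasure α β lam {0} = 0 := by
  rw [← lintegral_indicator_one (measurableSet_singleton 0),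
    lintegral_levyMeasure α hβ _ (measurable_one.indicator (measurableSet_singleton 0))]
  have : ∀ (w : Sphere d) (x : ℝ), Real.exp x • (w : Space d) ∉ ({0} : Set (Space d)) := by
    intro w x h
    have h1 := norm_exp_smul x w
    rw [h, norm_zero] at h1
    exact (Real.exp_pos x).ne h1
  simp [Set.indicator_of_notMem (this _ _)]

end Laws

/-! ### The Sato subordinator -/

section Paths

variable {d : ℕ} {α q : ℝ} {β : Sphere d → ℝ} {Ω : Type u} {A : ℕ × ℕ → Set Ω}
  {p : ℕ × ℕ → Ω → (Sphere d × ℝ) × ℝ}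

/-- Dominated convergence for series: norms of jumps increase with time, so the summable jumps at
`T` dominate those at all earlier times. -/
lemma tendsto_atomSum_jump (hα : 0 < α) (hβ : ∀ w, 0 < β w) (hq : 0 < q) {ω : Ω} {T : ℝ≥0}
    {𝓕 : Filter ℝ≥0} {g : ℕ × ℕ → Space d}
    (hs : Summable fun i => ‖(A i).indicator (fun ω => jump α q β T (p i ω)) ω‖)
    (hT : ∀ᶠ s in 𝓕, s ≤ T)
    (hg : ∀ i, ω ∈ A i → Tendsto (fun s => jump α q β s (p i ω)) 𝓕 (𝓝 (g i)))
    (hg0 : ∀ i, ω ∉ A i → g i = 0) :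
    Tendsto (fun s => atomSum A p (jump α q β s) ω) 𝓕 (𝓝 (∑' i, g i)) := by
  refine tendsto_tsum_of_dominated_convergence hs (fun i => ?_) ?_
  · by_cases hi : ω ∈ A i
    · simpa [hi] using hg i hi
    · simpa [hi, hg0 i hi] using tendsto_const_nhds
  · filter_upwards [hT] with s hs i
    by_cases hi : ω ∈ A i
    · simpa [hi] using norm_jump_mono hα hq hβ (p i ω) hs
    · simp [hi]

lemma isCadlagPath_atomSum_jump (hα : 0 < α) (hβ : ∀ w, 0 < β w) (hq : 0 < q) {ω : Ω}
    (hs : ∀ t, Summable fun i => ‖(A i).indicator (fun ω => jump α q β t (p i ω)) ω‖) :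
    IsCadlagPath fun t => atomSum A p (jump α q β t) ω := by
  intro t
  have hle : ∀ᶠ s in 𝓝 t, s ≤ t + 1 :=
    (eventually_lt_nhds (lt_add_of_pos_right t one_pos)).mono fun _ => le_of_lt
  refine ⟨?_, ?_⟩
  · refine tendsto_atomSum_jump hα hβ hq (hs (t + 1)) (nhdsWithin_le_nhds hle) (fun i hi => ?_)
      fun i hi => Set.indicator_of_notMem hi _
    rw [Set.indicator_of_mem hi]
    exact continuousWithinAt_jump hα hq hβ (p i ω) t
  · choose l hl using fun e => exists_tendsto_jump_left (q := q) hα hq hβ e t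
    refine ⟨_, tendsto_atomSum_jump (g := fun i => (A i).indicator (fun ω => l (p i ω)) ω)
      hα hβ hq (hs (t + 1)) (nhdsWithin_le_nhds hle) (fun i hi => ?_)
      fun i hi => Set.indicator_of_notMem hi _⟩
    rw [Set.indicator_of_mem hi]
    exact hl _

/-- Summability is essential: a divergent sum takes the default value 0, and in the product space
one divergent coordinate would zero all of them. -/
lemma atomSum_pi {ι : Type*} [Fintype ι] {ω : Ω} {f : (Sphere d × ℝ) × ℝ → ι → Space d}
    (hs : ∀ j, Summable fun i => (A i).indicator (fun ω => f (p i ω) j) ω) :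
    (fun j => atomSum A p (fun e => f e j) ω) = atomSum A p f ω := by
  ext1 j
  have hs' : Summable fun i => (A i).indicator (fun ω => f (p i ω)) ω := by
    refine Pi.summable.2 fun j => (hs j).congr fun i => ?_
    by_cases hi : ω ∈ A i <;> simp [hi]
  rw [atomSum, atomSum, tsum_apply hs']
  congr 1
  ext1 i
  by_cases hi : ω ∈ A i <;> simp [hi]

end Paths

/-! ### The law of the process of summed jumps. -/

section SatoProcess

variable {d : ℕ} {α q : ℝ} {β : Sphere d → ℝ} {lam : Measure (Sphere d)} [IsFiniteMeasure lam]
  {Ω : Type u} [MeasurableSpace Ω] {P : Measure Ω}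
  {A : ℕ × ℕ → Set Ω} {p : ℕ × ℕ → Ω → (Sphere d × ℝ) × ℝ}

/-- Integer times give countably many almost sure events; monotonicity of the norms in time covers
the rest. -/
lemma ae_forall_summable_jump (h : IsPoissonPoints (jumpIntensity lam) P A p)
    (hα : α ∈ Set.Ioo (0 : ℝ) 1) (hβm : Measurable β) (hβ : ∀ w, 0 < β w) (hq : 0 < q) :
    ∀ᵐ ω ∂P, ∀ t, Summable fun i => ‖(A i).indicator (fun ω => jump α q β t (p i ω)) ω‖ := by
  have h1 : ∀ᵐ ω ∂P, ∀ n : ℕ,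
      Summable fun i => ‖(A i).indicator (fun ω => jump α q β n (p i ω)) ω‖ :=
    ae_all_iff.2 fun n => h.ae_summable_norm (measurable_jump hβm _)
      (lintegral_min_norm_jump_lt_top hα hβm hβ _)
  filter_upwards [h1] with ω hω t
  obtain ⟨n, hn⟩ := exists_nat_ge t
  refine (hω n).of_nonneg_of_le (fun i => norm_nonneg _) fun i => ?_
  by_cases hi : ω ∈ A i
  · simpa [hi] using norm_jump_mono hα.1 hq hβ (p i ω) hn
  · simp [hi]

lemma tendstoInMeasure_atomSum_jump [IsProbabilityMeasure P]
    (h : IsPoissonPoints (jumpIntensity lam) P A p)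
    (hα : α ∈ Set.Ioo (0 : ℝ) 1) (hβm : Measurable β) (hβ : ∀ w, 0 < β w) (hq : 0 < q) (t : ℝ≥0) :
    TendstoInMeasure P (fun t => atomSum A p (jump α q β t)) (𝓝 t) (atomSum A p (jump α q β t)) := by
  have hae : ∀ᵐ ω ∂P, Tendsto (fun s => atomSum A p (jump α q β s) ω) (𝓝 t)
      (𝓝 (atomSum A p (jump α q β t) ω)) := by
    filter_upwards [ae_forall_summable_jump h hα hβm hβ hq,
      h.ae_forall_of_ae (ae_snd_ne_level (q := q) hβm t)] with ω hs hne
    have hle : ∀ᶠ s in 𝓝 t, s ≤ t + 1 :=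
      (eventually_lt_nhds (lt_add_of_pos_right t one_pos)).mono fun _ => le_of_lt
    refine tendsto_atomSum_jump hα.1 hβ hq (hs (t + 1)) hle (fun i hi => ?_)
      fun i hi => Set.indicator_of_notMem hi _
    rw [Set.indicator_of_mem hi]
    exact tendsto_jump_of_ne hα.1 hq hβ (hne i hi)
  intro ε hε
  -- Almost sure convergence implies convergence in measure along sequences, and these suffice
  -- because 𝓝 t is countably generated.
  refine tendsto_of_seq_tendsto fun s hs => ?_
  refine tendstoInMeasure_of_tendsto_ae (f := fun n => atomSum A p (jump α q β (s n)))
    (fun n => (h.measurable_atomSum (measurable_jump hβm _)).aestronglyMeasurable) ?_ ε hε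
  filter_upwards [hae] with ω hω using hω.comp hs

lemma lintegral_min_norm_pi_lt_top {ι : Type*} [Fintype ι] (hα : α ∈ Set.Ioo (0 : ℝ) 1)
    (hβm : Measurable β) (hβ : ∀ w, 0 < β w) {f : (Sphere d × ℝ) × ℝ → ι → Space d} {T : ℝ≥0}
    {c : ℝ} (hc : 0 ≤ c) (hf : ∀ e j, ‖f e j‖ ≤ c * ‖jump α q β T e‖) :
    ∫⁻ e, min ‖f e‖ₑ 1 ∂(jumpIntensity lam) < ∞ := by
  have h1 := lintegral_min_norm_jump_lt_top (lam := lam) (q := q) hα hβm hβ T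
  refine lt_of_le_of_lt (lintegral_mono fun e => ?_ :
    _ ≤ ∫⁻ e, (ENNReal.ofReal c + 1) * min ‖jump α q β T e‖ₑ 1 ∂(jumpIntensity lam)) ?_
  · rw [mul_min]
    refine min_le_min ?_ ?_
    · have : ‖f e‖ ≤ c * ‖jump α q β T e‖ :=
        (pi_norm_le_iff_of_nonneg (by positivity)).2 (hf e)
      rw [← ofReal_norm, ← ofReal_norm]
      refine (ENNReal.ofReal_le_ofReal this).trans ?_
      rw [ENNReal.ofReal_mul hc]
      gcongr; exact le_self_add
    · rw [mul_one]; exact le_add_self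
  · rw [lintegral_const_mul' _ _ (by simp)]
    exact ENNReal.mul_lt_top (by simp) h1

/-- The vector of increments is a single Poisson sum of `f`. Each point jumps in at most one of the
intervals, so e^{iL(f)} - 1 is the sum of its one-interval versions and the joint characteristic
function factorizes. -/
lemma hasIndepIncrements_atomSum_jump [IsProbabilityMeasure P]
    (h : IsPoissonPoints (jumpIntensity lam) P A p)
    (hα : α ∈ Set.Ioo (0 : ℝ) 1) (hβm : Measurable β) (hβ : ∀ w, 0 < β w) (hq : 0 < q) :
    HasIndepIncrements (fun t => atomSum A p (jump α q β t)) P := by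
  intro n t ht
  set f : (Sphere d × ℝ) × ℝ → Fin n → Space d :=
    fun e i => jump α q β (t i.succ) e - jump α q β (t i.castSucc) e with hf
  have hfm : Measurable f := measurable_pi_lambda _ fun i =>
    (measurable_jump hβm _).sub (measurable_jump hβm _)
  have hbd : ∀ e i, ‖f e i‖ ≤ 1 * ‖jump α q β (t (Fin.last n)) e‖ := by
    intro e i
    rw [one_mul]
    refine le_trans ?_ (norm_jump_mono hα.1 hq hβ e (ht (Fin.le_last i.succ)))
    have hm := jumped_mono (α := α) (q := q) hα.1 hq hβ (ht (Fin.castSucc_lt_succ (i := i)).le)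
    by_cases h1 : e ∈ jumped α q β (t i.castSucc)
    · simp [hf, jump, h1, hm h1]
    · simp [hf, jump, h1]
  have hfin := lintegral_min_norm_pi_lt_top (lam := lam) hα hβm hβ zero_le_one hbd
  have hbd' : ∀ i, ∫⁻ e, min ‖f e i‖ₑ 1 ∂(jumpIntensity lam) < ∞ := fun i =>
    lt_of_le_of_lt (lintegral_mono fun e => min_le_min_right _ (by
      rw [← ofReal_norm, ← ofReal_norm]
      exact ENNReal.ofReal_le_ofReal (norm_le_pi_norm (f e) i))) hfin
  have hXm : ∀ i : Fin n, Measurable fun ω => atomSum A p (jump α q β (t i.succ)) ω -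
      atomSum A p (jump α q β (t i.castSucc)) ω := fun i =>
    (h.measurable_atomSum (measurable_jump hβm _)).sub
      (h.measurable_atomSum (measurable_jump hβm _))
  have hX : ∀ᵐ ω ∂P, ∀ i : Fin n, atomSum A p (jump α q β (t i.succ)) ω -
      atomSum A p (jump α q β (t i.castSucc)) ω = atomSum A p (fun e => f e i) ω ∧
        Summable fun k => (A k).indicator (fun ω => f (p k ω) i) ω := by
    filter_upwards [ae_forall_summable_jump h hα hβm hβ hq] with ω hs i
    have h1 := ((hs (t i.succ)).of_norm.hasSum).sub (hs (t i.castSucc)).of_norm.hasSum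
    have h2 : (fun k => (A k).indicator (fun ω => f (p k ω) i) ω) = fun k =>
        (A k).indicator (fun ω => jump α q β (t i.succ) (p k ω)) ω -
          (A k).indicator (fun ω => jump α q β (t i.castSucc) (p k ω)) ω := by
      ext1 k
      by_cases hk : ω ∈ A k <;> simp [hk, hf]
    refine ⟨?_, h2 ▸ h1.summable⟩
    rw [atomSum, atomSum, atomSum, h2, h1.tsum_eq]
  rw [iIndepFun_iff_charFunDual_pi fun i => (hXm i).aemeasurable]
  intro L
  have hmap : P.map (fun ω i => atomSum A p (jump α q β (t (Fin.succ i))) ω -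
      atomSum A p (jump α q β (t (Fin.castSucc i))) ω) = P.map (atomSum A p f) := by
    refine Measure.map_congr ?_
    filter_upwards [hX] with ω hω
    rw [← atomSum_pi fun i => (hω i).2]
    exact funext fun i => (hω i).1
  have hmapi : ∀ i, P.map (fun ω => atomSum A p (jump α q β (t (Fin.succ i))) ω -
      atomSum A p (jump α q β (t (Fin.castSucc i))) ω) = P.map (atomSum A p fun e => f e i) :=
    fun i => Measure.map_congr (by filter_upwards [hX] with ω hω using (hω i).1)
  rw [hmap, h.charFunDual_map_atomSum hfm hfin]
  simp only [hmapi]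
  have hfi : ∀ i, Measurable fun e => f e i := fun i => (measurable_pi_apply i).comp hfm
  rw [Finset.prod_congr rfl fun i _ => h.charFunDual_map_atomSum (hfi i) (hbd' i)
    (L.comp (.single ℝ (fun _ => Space d) i)), ← Complex.exp_sum, ← integral_finsetSum]
  swap
  · intro i _
    exact integrable_exp_sub_one (by have := hfi i; fun_prop)
      (IsPoissonPoints.lintegral_min_clm_lt_top _ (hbd' i))
  congr 1
  refine integral_congr_ae (ae_of_all _ fun e => ?_)
  simp only
  -- A point that jumps in the i-th interval has already jumped at both ends of the j-th, so its
  -- later increment cancels.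
  have hdisj : ∀ i j, i < j → f e i ≠ 0 → f e j = 0 := by
    intro i j hij hi
    have h1 : e ∈ jumped α q β (t i.succ) := by
      by_contra hcon
      have h2 : e ∉ jumped α q β (t i.castSucc) := fun h' =>
        hcon (jumped_mono hα.1 hq hβ (ht (Fin.castSucc_lt_succ (i := i)).le) h')
      exact hi (by simp [hf, jump, hcon, h2])
    have h2 : e ∈ jumped α q β (t j.castSucc) :=
      jumped_mono hα.1 hq hβ (ht (Fin.succ_le_castSucc_iff.2 hij)) h1
    have h3 : e ∈ jumped α q β (t j.succ) :=
      jumped_mono hα.1 hq hβ (ht (Fin.castSucc_lt_succ (i := j)).le) h2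
    simp [hf, jump, h2, h3]
  have hsum : L (f e) = ∑ i, L (ContinuousLinearMap.single ℝ (fun _ => Space d) i (f e i)) := by
    simpa using (ContinuousLinearMap.sum_comp_single ℝ (fun _ => Space d) L (f e)).symm
  simp only [ContinuousLinearMap.comp_apply]
  rw [hsum]
  by_cases hall : ∀ i, f e i = 0
  · simp [hall]
  · push Not at hall
    obtain ⟨i, hi⟩ := hall
    have hz : ∀ j, j ≠ i → f e j = 0 := fun j hj => by
      rcases lt_or_gt_of_ne hj with hlt | hgt
      · by_contra hcon
        exact hi (hdisj j i hlt hcon)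
      · exact hdisj i j hgt hi
    rw [Finset.sum_eq_single i (fun j _ hj => by rw [hz j hj]; simp) (by simp),
      Finset.sum_eq_single i (fun j _ hj => by rw [hz j hj]; simp) (by simp)]

/-- Each finite-dimensional law is that of one Poisson sum, of `f` or of `g`; these functions differ
by a map preserving the intensity. -/
lemma isSelfSimilar_atomSum_jump [IsProbabilityMeasure P]
    (h : IsPoissonPoints (jumpIntensity lam) P A p)
    (hα : α ∈ Set.Ioo (0 : ℝ) 1) (hβm : Measurable β) (hβ : ∀ w, 0 < β w) (hq : 0 < q) :
    IsSelfSimilar q (fun t => atomSum A p (jump α q β t)) P := by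
  intro a ha
  have hm : ∀ t, Measurable (atomSum A p (jump α q β t)) := fun t =>
    h.measurable_atomSum (measurable_jump hβm t)
  have hm1 : Measurable fun ω t => atomSum A p (jump α q β (a * t)) ω :=
    measurable_pi_lambda _ fun t => hm _
  have hm2 : Measurable fun ω t => (a : ℝ) ^ q • atomSum A p (jump α q β t) ω :=
    measurable_pi_lambda _ fun t => (hm t).const_smul ((a : ℝ) ^ q)
  rw [identDistrib_iff_forall_finset_identDistrib hm1.aemeasurable hm2.aemeasurable]
  intro I
  refine ⟨((Finset.measurable_restrict I).comp hm1).aemeasurable,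
    ((Finset.measurable_restrict I).comp hm2).aemeasurable, ?_⟩
  set f : (Sphere d × ℝ) × ℝ → I → Space d := fun e t => jump α q β (a * t) e with hf
  set g : (Sphere d × ℝ) × ℝ → I → Space d := fun e t => (a : ℝ) ^ q • jump α q β t e with hg
  have hfm : Measurable f := measurable_pi_lambda _ fun i => measurable_jump hβm _
  have hgm : Measurable g := measurable_pi_lambda _ fun i => (measurable_jump hβm _).const_smul ((a : ℝ) ^ q)
  have hle : ∀ i : I, (i : ℝ≥0) ≤ I.sup id := fun i => Finset.le_sup (f := id) i.2
  have hffin : ∫⁻ e, min ‖f e‖ₑ 1 ∂(jumpIntensity lam) < ∞ := by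
    refine lintegral_min_norm_pi_lt_top (q := q) (T := a * I.sup id) hα hβm hβ zero_le_one
      fun e i => ?_
    rw [one_mul]
    exact norm_jump_mono hα.1 hq hβ e (by have := hle i; gcongr)
  have hgfin : ∫⁻ e, min ‖g e‖ₑ 1 ∂(jumpIntensity lam) < ∞ := by
    refine lintegral_min_norm_pi_lt_top (q := q) (T := I.sup id) (c := (a : ℝ) ^ q) hα hβm hβ
      (by positivity) fun e i => ?_
    rw [hg, norm_smul, Real.norm_of_nonneg (by positivity)]
    gcongr
    exact norm_jump_mono hα.1 hq hβ e (hle i)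
  have hs := ae_forall_summable_jump (q := q) h hα hβm hβ hq
  have hmapf : P.map (fun ω => I.restrict fun t => atomSum A p (jump α q β (a * t)) ω) =
      P.map (atomSum A p f) := by
    refine Measure.map_congr ?_
    filter_upwards [hs] with ω hω
    have h2 : ∀ i : I, Summable fun k => (A k).indicator (fun ω => f (p k ω) i) ω := fun i =>
      (hω (a * i)).of_norm
    rw [← atomSum_pi (f := f) h2]
    rfl
  have hmapg : P.map (fun ω => I.restrict fun t => (a : ℝ) ^ q • atomSum A p (jump α q β t) ω) =
      P.map (atomSum A p g) := by
    refine Measure.map_congr ?_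
    filter_upwards [hs] with ω hω
    have h2 : ∀ i : I, (fun k => (A k).indicator (fun ω => g (p k ω) i) ω) = fun k =>
        (a : ℝ) ^ q • (A k).indicator (fun ω => jump α q β i (p k ω)) ω := fun i => by
      ext1 k
      by_cases hk : ω ∈ A k <;> simp [hk, hg]
    have h3 : ∀ i : I, Summable fun k => (A k).indicator (fun ω => g (p k ω) i) ω := fun i => by
      rw [h2 i]; exact (hω i).of_norm.const_smul ((a : ℝ) ^ q)
    rw [← atomSum_pi (f := g) h3]
    ext1 i
    have h4 := (hω i).of_norm.tsum_const_smul ((a : ℝ) ^ q)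
    rw [← h2 i] at h4
    exact h4.symm
  rw [hmapf, hmapg]
  have hp1 : IsProbabilityMeasure (P.map (atomSum A p f)) :=
    Measure.isProbabilityMeasure_map (h.measurable_atomSum hfm).aemeasurable
  have hp2 : IsProbabilityMeasure (P.map (atomSum A p g)) :=
    Measure.isProbabilityMeasure_map (h.measurable_atomSum hgm).aemeasurable
  refine Measure.ext_of_charFunDual ?_
  ext L
  rw [h.charFunDual_map_atomSum hfm hffin, h.charFunDual_map_atomSum hgm hgfin,
    ← (measurePreserving_scaleEquiv lam (q * Real.log a)).integral_comp']
  congr 1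
  refine integral_congr_ae (ae_of_all _ fun e => ?_)
  have : f (scaleEquiv d (q * Real.log a) e) = g e := funext fun i => jump_scaleEquiv ha i e
  simp only [this]

theorem isSatoSubordinator_atomSum_jump [IsProbabilityMeasure P]
    (h : IsPoissonPoints (jumpIntensity lam) P A p)
    (hα : α ∈ Set.Ioo (0 : ℝ) 1) (hβm : Measurable β) (hβ : ∀ w, 0 < β w) (hq : 0 < q)
    (hlam : lam (positiveSphere d)ᶜ = 0) :
    IsSatoSubordinator q (fun t => atomSum A p (jump α q β t)) P := by
  have hs := ae_forall_summable_jump (q := q) h hα hβm hβ hq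
  have hzero : ∀ ω, atomSum A p (jump α q β 0) ω = 0 := fun ω => by
    have : ∀ i, (A i).indicator (fun ω => jump α q β 0 (p i ω)) ω = 0 := fun i => by
      by_cases hi : ω ∈ A i <;> simp [hi, jump_zero]
    simp [atomSum, this]
  have hmono : ∀ᵐ ω ∂P, ∀ i, Monotone fun t => atomSum A p (jump α q β t) ω i := by
    filter_upwards [hs, h.ae_forall_of_ae (ae_mem_of_compl_null hlam)] with ω hω hpos i s t hst
    have hi : ∀ t, HasSum (fun k => (A k).indicator (fun ω => jump α q β t (p k ω)) ω i)
        (atomSum A p (jump α q β t) ω i) := fun t =>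
      (hω t).of_norm.hasSum.mapL (EuclideanSpace.proj i : Space d →L[ℝ] ℝ)
    refine hasSum_le (fun k => ?_) (hi s) (hi t)
    by_cases hk : ω ∈ A k
    · simpa [hk] using jump_mono_of_nonneg hα.1 hq hβ (hpos k hk) i hst
    · simp [hk]
  refine ⟨⟨⟨fun t => h.measurable_atomSum (measurable_jump hβm t),
    hasIndepIncrements_atomSum_jump h hα hβm hβ hq, ae_of_all _ hzero,
    tendstoInMeasure_atomSum_jump h hα hβm hβ hq, ?_⟩,
    isSelfSimilar_atomSum_jump h hα hβm hβ hq⟩, ?_, hmono⟩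
  · filter_upwards [hs] with ω hω using isCadlagPath_atomSum_jump hα.1 hβ hq hω
  · filter_upwards [hmono] with ω hω i t
    simpa [hzero] using hω i (zero_le : 0 ≤ t)

lemma charFun_atomSum_jump_one (h : IsPoissonPoints (jumpIntensity lam) P A p)
    (hα : α ∈ Set.Ioo (0 : ℝ) 1) (hβm : Measurable β) (hβ : ∀ w, 0 < β w) (z : Space d) :
    charFun (P.map (atomSum A p (jump α q β 1))) z =
      Complex.exp (∫ x, (Complex.exp (Complex.I * (⟪z, x⟫ : ℝ)) - 1) ∂(levyMeasure α β lam)) := by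
  rw [charFun_eq_charFunDual_toDualMap, h.charFunDual_map_atomSum (measurable_jump hβm 1)
    (lintegral_min_norm_jump_lt_top hα hβm hβ 1),
    ← integral_comp_jump_one (q := q) hβm (k := fun x => Complex.exp (Complex.I * (⟪z, x⟫ : ℝ)) - 1)
      (by fun_prop) (by simp)]
  simp

theorem existsDriftlessSatoSubordinator (hα : α ∈ Set.Ioo (0 : ℝ) 1) (hβm : Measurable β)
    (hβ : ∀ w, 0 < β w) (hq : 0 < q) (hlam0 : lam ≠ 0) (hlam : lam (positiveSphere d)ᶜ = 0) :
    ExistsDriftlessSatoSubordinator.{u} q α β lam := by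
  -- The sphere is empty for d = 0; a nonzero measure on it excludes this.
  have hne : Nonempty (Sphere d) := by
    by_contra hcon
    rw [not_nonempty_iff] at hcon
    exact hlam0 (Subsingleton.elim _ _)
  have : SFinite (jumpIntensity lam) := by unfold jumpIntensity; infer_instance
  obtain ⟨Ω, _, P, A, p, hP, h⟩ := exists_isPoissonPoints.{u} (jumpIntensity lam)
  have hν := lintegral_min_norm_levyMeasure_lt_top (lam := lam) hα hβm hβ
  have hc := charFun_atomSum_jump_one (q := q) h hα hβm hβ
  have hprob : IsProbabilityMeasure (P.map (atomSum A p (jump α q β 1))) :=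
    Measure.isProbabilityMeasure_map (h.measurable_atomSum (measurable_jump hβm 1)).aemeasurable
  refine ⟨Ω, inferInstance, P, _, hP, isSatoSubordinator_atomSum_jump h hα hβm hβ hq hlam,
    ⟨hprob, isInfinitelyDivisible_of_charFun hν hc, _,
      hasLevyKhintchine_of_charFun hν (levyMeasure_singleton_zero α hβm lam) hc⟩, ?_, hc⟩
  exact (integrableOn_closedBall hν).hasFiniteIntegral

end SatoProcess

/-! ### Necessity: the jumps of a nonnegative law have bounded variation -/

section BoundedVariation

variable {d : ℕ} {μ ν ρ : Measure (Space d)}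

lemma inner_single (x : Space d) (i : Fin d) (s : ℝ) :
    ⟪x, EuclideanSpace.single i s⟫ = s * x i := by
  simp [EuclideanSpace.inner_single_right]

lemma measurable_euclideanSpace_single (i : Fin d) :
    Measurable fun s : ℝ => (EuclideanSpace.single i s : Space d) := by
  have : (fun s : ℝ => (EuclideanSpace.single i s : Space d)) =
      fun s => s • EuclideanSpace.single i (1 : ℝ) := by
    ext s j
    simp
  rw [this]; fun_prop

/-- Fubini and the Cauchy characteristic function turn a Laplace-type transform into an average of
`charFun` along one axis. -/
lemma integral_exp_neg_abs_eq [IsProbabilityMeasure ρ] (i : Fin d) :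
    ((∫ x, Real.exp (-|x i|) ∂ρ : ℝ) : ℂ) =
      ∫ s, charFun ρ (EuclideanSpace.single i s) ∂(cauchyMeasure 0 1) := by
  have hint : Integrable (Function.uncurry fun (s : ℝ) (x : Space d) =>
      Complex.exp (Complex.I * (s * x i : ℝ))) ((cauchyMeasure 0 1).prod ρ) := by
    refine (integrable_const (1 : ℝ)).mono' (Measurable.aestronglyMeasurable ?_)
      (ae_of_all _ fun b => ?_)
    · unfold Function.uncurry; fun_prop
    · rw [Function.uncurry, mul_comm, Complex.norm_exp_ofReal_mul_I]
  have h1 : ∀ s : ℝ, charFun ρ (EuclideanSpace.single i s) =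
      ∫ x, Complex.exp (Complex.I * (s * x i : ℝ)) ∂ρ := fun s => by
    rw [charFun_apply]
    simp only [inner_single, mul_comm Complex.I]
  simp only [h1]
  rw [integral_integral_swap hint]
  simp only [integral_exp_cauchyMeasure]
  exact integral_complex_ofReal.symm

lemma integrable_exp_neg_coord [IsProbabilityMeasure ρ] (i : Fin d) (h : ρ {x | x i < 0} = 0) :
    Integrable (fun x : Space d => Real.exp (-x i)) ρ := by
  refine (integrable_const (1 : ℝ)).mono' (Measurable.aestronglyMeasurable (by fun_prop)) ?_
  have : ∀ᵐ x ∂ρ, ¬ (x i < 0) := by simpa [ae_iff] using h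
  filter_upwards [this] with x hx
  rw [Real.norm_of_nonneg (Real.exp_pos _).le]
  exact Real.exp_le_one_iff.2 (by linarith)

/-- From e^{-u} ≤ 1/(1+u) one gets n(1 - e^{-y/n}) ≥ ny/(n+y), which is at least half of min(y, n).
-/
lemma min_le_mul_one_sub_exp {y : ℝ} (hy : 0 ≤ y) {n : ℕ} (hn : 1 ≤ n) :
    min y n ≤ 2 * (n * (1 - Real.exp (-y / n))) := by
  have hn' : (1 : ℝ) ≤ n := by exact_mod_cast hn
  have h1 : 0 ≤ y / n := by positivity
  have h2 : Real.exp (-y / n) ≤ 1 / (1 + y / n) := by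
    rw [neg_div, Real.exp_neg, ← one_div]
    exact one_div_le_one_div_of_le (by positivity) (by linarith [Real.add_one_le_exp (y / n)])
  have h3 : 1 / (1 + y / n) = n / (n + y) := by field_simp
  have h4 : min y n ≤ 2 * (n * (1 - n / (n + y))) := by
    have h5 : 1 - (n : ℝ) / (n + y) = y / (n + y) := by field_simp; ring
    rw [h5, ← mul_div_assoc, ← mul_div_assoc, le_div_iff₀ (by positivity)]
    rcases le_total y n with h | h
    · rw [min_eq_left h]; nlinarith
    · rw [min_eq_right h]; nlinarith
  refine h4.trans ?_
  rw [← h3]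
  gcongr

lemma iSup_ofReal_min_natCast (y : ℝ) :
    ⨆ n : ℕ, ENNReal.ofReal (min y (n + 1 : ℕ)) = ENNReal.ofReal y := by
  refine le_antisymm (iSup_le fun n => ENNReal.ofReal_le_ofReal (min_le_left _ _)) ?_
  obtain ⟨n, hn⟩ := exists_nat_ge y
  refine le_iSup_of_le n (le_of_eq ?_)
  rw [min_eq_left]
  push_cast; linarith

/-- For the n-th root with Laplace value a at coordinate i, Λ = a^n gives n(1 - a) ≤ -log Λ, while a
≤ ∫ e^{-y/n} under the Cauchy law. Hence the integral of n(1 - e^{-y/n}) is bounded uniformly in n,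
and monotone convergence of min(y, n) finishes. -/
theorem lintegral_neg_log_charFun_lt_top [IsProbabilityMeasure μ] (hμ : IsInfinitelyDivisible μ)
    (i : Fin d) (h0 : μ {x | x i < 0} = 0)
    (hne : ∀ s : ℝ, charFun μ (EuclideanSpace.single i s) ≠ 0) :
    ∫⁻ s, ENNReal.ofReal (-Real.log ‖charFun μ (EuclideanSpace.single i s)‖) ∂(cauchyMeasure 0 1)
      < ∞ := by
  set y : ℝ → ℝ := fun s => -Real.log ‖charFun μ (EuclideanSpace.single i s)‖ with hy
  have hcont : Measurable fun s : ℝ => charFun μ (EuclideanSpace.single i s) :=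
    measurable_charFun.comp (measurable_euclideanSpace_single i)
  have hym : Measurable y := (Real.measurable_log.comp hcont.norm).neg
  have hy0 : ∀ s, 0 ≤ y s := fun s =>
    neg_nonneg.2 (Real.log_nonpos (norm_nonneg _) (norm_charFun_le_one _))
  set Λ : ℝ := ∫ x, Real.exp (-x i) ∂μ with hΛ
  have hbound : ∀ n : ℕ, 1 ≤ n → ∫⁻ s, ENNReal.ofReal (min (y s) n) ∂(cauchyMeasure 0 1) ≤
      ENNReal.ofReal (2 * -Real.log Λ) := by
    intro n hn
    obtain ⟨ρ, hρ, hμρ⟩ := hμ n hn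
    have hn0 : n ≠ 0 := by omega
    have hsum : Measurable fun x : Fin n → Space d => ∑ j, x j := by fun_prop
    have hA : MeasurableSet {x : Space d | x i < 0} :=
      measurableSet_lt (by fun_prop) measurable_const
    -- If all n independent summands are negative at i then so is their sum, so the n-th power of
    -- this mass is at most zero.
    have hρ0 : ρ {x | x i < 0} = 0 := by
      have h1 : (Measure.pi fun _ : Fin n => ρ) (Set.univ.pi fun _ => {x | x i < 0}) ≤
          μ {x | x i < 0} := by
        rw [hμρ, Measure.map_apply hsum hA]
        refine measure_mono fun x hx => ?_
        have hx' : ∀ j, x j i < 0 := fun j => hx j (Set.mem_univ j)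
        have : (∑ j, x j) i = ∑ j, x j i := by simp
        have hne : (Finset.univ : Finset (Fin n)).Nonempty := ⟨⟨0, hn⟩, Finset.mem_univ _⟩
        show (∑ j, x j) i < 0
        rw [this]
        exact Finset.sum_neg (fun j _ => hx' j) hne
      rw [h0, Measure.pi_pi] at h1
      simpa [hn0] using h1
    have hΛn : Λ = (∫ x, Real.exp (-x i) ∂ρ) ^ n := by
      rw [hΛ, hμρ, integral_map hsum.aemeasurable (Measurable.aestronglyMeasurable (by fun_prop))]
      have h2 := integral_fintype_prod_eq_pow (ι := Fin n) (μ := ρ)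
        (fun x : Space d => Real.exp (-x i))
      rw [Fintype.card_fin] at h2
      rw [← h2]
      refine integral_congr_ae (ae_of_all _ fun x => ?_)
      simp only
      rw [← Real.exp_sum]
      simp
    have hnorm : ∀ s, ‖charFun ρ (EuclideanSpace.single i s)‖ = Real.exp (-y s / n) := by
      intro s
      have h1 : charFun μ (EuclideanSpace.single i s) =
          charFun ρ (EuclideanSpace.single i s) ^ n := by
        rw [hμρ, charFun_map_sum_pi_eq_prod, Finset.prod_apply]
        simp
      have h2 : y s = -(n * Real.log ‖charFun ρ (EuclideanSpace.single i s)‖) := by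
        rw [hy]; simp only
        rw [h1, norm_pow, Real.log_pow]
      have h3 : charFun ρ (EuclideanSpace.single i s) ≠ 0 := fun h => hne s (by
        rw [h1, h, zero_pow hn0])
      have hn' : (n : ℝ) ≠ 0 := by exact_mod_cast hn0
      rw [h2, neg_neg, mul_div_cancel_left₀ _ hn', Real.exp_log (norm_pos_iff.2 h3)]
    set a : ℝ := ∫ x, Real.exp (-x i) ∂ρ with ha
    have hapos : 0 < a := integral_exp_pos (integrable_exp_neg_coord i hρ0)
    have hexpint : Integrable (fun s => Real.exp (-y s / n)) (cauchyMeasure 0 1) := by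
      refine (integrable_const (1 : ℝ)).mono' (Measurable.aestronglyMeasurable (by fun_prop))
        (ae_of_all _ fun s => ?_)
      rw [Real.norm_of_nonneg (Real.exp_pos _).le]
      exact Real.exp_le_one_iff.2 (div_nonpos_of_nonpos_of_nonneg (by linarith [hy0 s])
        (Nat.cast_nonneg n))
    have hale : a ≤ ∫ s, Real.exp (-y s / n) ∂(cauchyMeasure 0 1) := by
      have h1 : a = ∫ x, Real.exp (-|x i|) ∂ρ := by
        refine integral_congr_ae ?_
        have : ∀ᵐ x ∂ρ, ¬ (x i < 0) := by simpa [ae_iff] using hρ0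
        filter_upwards [this] with x hx
        rw [abs_of_nonneg (not_lt.1 hx)]
      have h2 := congrArg norm (integral_exp_neg_abs_eq (ρ := ρ) i)
      rw [← h1, Complex.norm_real, Real.norm_of_nonneg hapos.le] at h2
      rw [h2]
      refine (norm_integral_le_integral_norm _).trans (le_of_eq ?_)
      simp only [hnorm]
    have hlog : (n : ℝ) * (1 - a) ≤ -Real.log Λ := by
      rw [hΛn, Real.log_pow]
      have := Real.log_le_sub_one_of_pos hapos
      have hn' : (0 : ℝ) ≤ n := Nat.cast_nonneg n
      nlinarith
    calc ∫⁻ s, ENNReal.ofReal (min (y s) n) ∂(cauchyMeasure 0 1)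
        ≤ ∫⁻ s, ENNReal.ofReal (2 * (n * (1 - Real.exp (-y s / n)))) ∂(cauchyMeasure 0 1) :=
          lintegral_mono fun s => ENNReal.ofReal_le_ofReal (min_le_mul_one_sub_exp (hy0 s) hn)
      _ = ENNReal.ofReal (∫ s, 2 * (n * (1 - Real.exp (-y s / n))) ∂(cauchyMeasure 0 1)) := by
          rw [ofReal_integral_eq_lintegral_ofReal]
          · exact (((integrable_const _).sub hexpint).const_mul _).const_mul _
          · refine ae_of_all _ fun s => ?_
            have : (0 : ℝ) ≤ min (y s) n := le_min (hy0 s) (Nat.cast_nonneg n)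
            exact this.trans (min_le_mul_one_sub_exp (hy0 s) hn)
      _ ≤ ENNReal.ofReal (2 * -Real.log Λ) := by
          refine ENNReal.ofReal_le_ofReal ?_
          rw [integral_const_mul, integral_const_mul, integral_sub (integrable_const _) hexpint]
          simp only [integral_const, probReal_univ, one_smul]
          have hn' : (0 : ℝ) ≤ n := Nat.cast_nonneg n
          nlinarith
  have hsup : ∫⁻ s, ENNReal.ofReal (y s) ∂(cauchyMeasure 0 1) =
      ⨆ n : ℕ, ∫⁻ s, ENNReal.ofReal (min (y s) (n + 1 : ℕ)) ∂(cauchyMeasure 0 1) := by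
    rw [← lintegral_iSup]
    · simp only [iSup_ofReal_min_natCast]
    · exact fun n => (hym.min measurable_const).ennreal_ofReal
    · intro m n hmn s
      refine ENNReal.ofReal_le_ofReal (min_le_min_left _ ?_)
      exact_mod_cast Nat.succ_le_succ hmn
  rw [hsup]
  exact (iSup_le fun n => hbound (n + 1) (by omega)).trans_lt ENNReal.ofReal_lt_top

lemma norm_exp_I_mul_sub_sub_le (u : ℝ) :
    ‖Complex.exp (Complex.I * u) - 1 - Complex.I * u‖ ≤ 3 * u ^ 2 := by
  have hn : ‖Complex.I * (u : ℂ)‖ = |u| := by simp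
  rcases le_total |u| 1 with h | h
  · refine (Complex.norm_exp_sub_one_sub_id_le (by rw [hn]; exact h)).trans ?_
    rw [hn, sq_abs]; nlinarith [sq_nonneg u]
  · refine (norm_sub_le _ _).trans ?_
    have h1 := Real.norm_exp_I_mul_ofReal_sub_one_le (x := u)
    rw [Real.norm_eq_abs] at h1
    rw [hn, ← sq_abs]
    nlinarith

lemma integrable_levyKhintchine (hν : IsLevyMeasure ν) (z : Space d) :
    Integrable (fun x => Complex.exp (Complex.I * (⟪z, x⟫ : ℝ)) - 1 -
      (Metric.closedBall (0 : Space d) 1).indicator (fun y => Complex.I * (⟪z, y⟫ : ℝ)) x) ν := by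
  have hi : Integrable (fun x : Space d => min (‖x‖ ^ 2) 1) ν := by
    refine ⟨Measurable.aestronglyMeasurable (by fun_prop), ?_⟩
    refine lt_of_le_of_lt (lintegral_mono fun x => le_of_eq ?_) hν.2
    exact Real.enorm_eq_ofReal (by positivity)
  refine (hi.const_mul (3 * ‖z‖ ^ 2 + 2)).mono' ?_ (ae_of_all _ fun x => ?_)
  · refine Measurable.aestronglyMeasurable (Measurable.sub (by fun_prop) ?_)
    exact Measurable.indicator (by fun_prop) Metric.isClosed_closedBall.measurableSet
  · by_cases hx : x ∈ Metric.closedBall (0 : Space d) 1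
    · rw [Set.indicator_of_mem hx]
      have hx1 : ‖x‖ ≤ 1 := by simpa using hx
      have h1 : ‖x‖ ^ 2 ≤ 1 := by nlinarith [norm_nonneg x]
      rw [min_eq_left h1]
      refine (norm_exp_I_mul_sub_sub_le _).trans ?_
      have h2 : ⟪z, x⟫ ^ 2 ≤ (‖z‖ * ‖x‖) ^ 2 := sq_le_sq' (by
        linarith [neg_le_of_abs_le (abs_real_inner_le_norm z x)]) (real_inner_le_norm z x)
      nlinarith [sq_nonneg ‖x‖]
    · rw [Set.indicator_of_notMem hx, sub_zero]
      have hx1 : 1 < ‖x‖ := by simpa using hx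
      have h1 : 1 ≤ ‖x‖ ^ 2 := by nlinarith
      rw [min_eq_right h1]
      refine (norm_sub_le _ _).trans ?_
      rw [mul_comm, Complex.norm_exp_ofReal_mul_I, norm_one]
      nlinarith [sq_nonneg ‖z‖]

lemma re_levyKhintchine (z x : Space d) :
    (Complex.exp (Complex.I * (⟪z, x⟫ : ℝ)) - 1 - (Metric.closedBall (0 : Space d) 1).indicator
      (fun y => Complex.I * (⟪z, y⟫ : ℝ)) x).re = -(1 - Real.cos ⟪z, x⟫) := by
  by_cases hx : x ∈ Metric.closedBall (0 : Space d) 1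
  · rw [Set.indicator_of_mem hx]; simp [Complex.exp_re]
  · rw [Set.indicator_of_notMem hx]; simp [Complex.exp_re]

lemma integrable_one_sub_cos (hν : IsLevyMeasure ν) (z : Space d) :
    Integrable (fun x => 1 - Real.cos ⟪z, x⟫) ν := by
  refine (integrable_levyKhintchine hν z).re.neg.congr (ae_of_all _ fun x => ?_)
  exact neg_eq_iff_eq_neg.2 (re_levyKhintchine z x)

/-- The drift and the compensator contribute only imaginary parts to the exponent. -/
lemma norm_charFun_of_hasLevyKhintchine {γ : Space d} (h : HasLevyKhintchine μ γ ν) (z : Space d) :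
    ‖charFun μ z‖ = Real.exp (-∫ x, (1 - Real.cos ⟪z, x⟫) ∂ν) := by
  rw [h.2, Complex.norm_exp, Complex.add_re]
  congr 1
  have h1 := integral_re (integrable_levyKhintchine h.1 z)
  rw [← integral_neg]
  simp only [Complex.mul_re, Complex.I_re, Complex.ofReal_re, Complex.I_im, Complex.ofReal_im,
    zero_mul, mul_zero, sub_zero, zero_add]
  refine Eq.trans h1.symm (integral_congr_ae (ae_of_all _ fun x => ?_))
  exact re_levyKhintchine z x

lemma lintegral_one_sub_cos_cauchyMeasure (x : ℝ) :
    ∫⁻ s, ENNReal.ofReal (1 - Real.cos (s * x)) ∂(cauchyMeasure 0 1) =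
      ENNReal.ofReal (1 - Real.exp (-|x|)) := by
  have hint : Integrable (fun s : ℝ => Complex.exp (Complex.I * (s * x : ℝ)))
      (cauchyMeasure 0 1) := by
    refine (integrable_const (1 : ℝ)).mono' (Measurable.aestronglyMeasurable (by fun_prop))
      (ae_of_all _ fun b => ?_)
    rw [mul_comm, Complex.norm_exp_ofReal_mul_I]
  have hre : ∀ s : ℝ, RCLike.re (Complex.exp (Complex.I * (s * x : ℝ))) = Real.cos (s * x) :=
    fun s => by
      rw [mul_comm]
      exact Complex.exp_ofReal_mul_I_re (s * x)
  have hcos : Integrable (fun s : ℝ => Real.cos (s * x)) (cauchyMeasure 0 1) := by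
    have := hint.re
    simpa only [hre] using this
  have h1 : ∫ s, Real.cos (s * x) ∂(cauchyMeasure 0 1) = Real.exp (-|x|) := by
    have h2 := integral_re hint
    simp only [hre] at h2
    rw [h2, integral_exp_cauchyMeasure]
    exact Complex.ofReal_re _
  have hsub : Integrable (fun s : ℝ => 1 - Real.cos (s * x)) (cauchyMeasure 0 1) :=
    (integrable_const 1).sub hcos
  rw [← ofReal_integral_eq_lintegral_ofReal hsub
    (ae_of_all _ fun s => sub_nonneg.2 (Real.cos_le_one _)),
    integral_sub (integrable_const _) hcos, h1]
  simp

theorem lintegral_one_sub_exp_lt_top [SFinite ν] [IsProbabilityMeasure μ] {γ : Space d}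
    (hμ : IsInfinitelyDivisible μ) (h : HasLevyKhintchine μ γ ν) (i : Fin d)
    (h0 : μ {x | x i < 0} = 0) :
    ∫⁻ x, ENNReal.ofReal (1 - Real.exp (-|x i|)) ∂ν < ∞ := by
  have h1 := lintegral_neg_log_charFun_lt_top hμ i h0 fun s => by
    rw [← norm_pos_iff, norm_charFun_of_hasLevyKhintchine h]
    exact Real.exp_pos _
  simp only [norm_charFun_of_hasLevyKhintchine h, Real.log_exp, neg_neg] at h1
  have h2 : ∀ s : ℝ, ENNReal.ofReal
      (∫ x, (1 - Real.cos ⟪EuclideanSpace.single i s, x⟫) ∂ν) =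
      ∫⁻ x, ENNReal.ofReal (1 - Real.cos (s * x i)) ∂ν := fun s => by
    rw [ofReal_integral_eq_lintegral_ofReal (integrable_one_sub_cos h.1 _)
      (ae_of_all _ fun s => sub_nonneg.2 (Real.cos_le_one _))]
    simp only [real_inner_comm, inner_single]
  simp only [h2] at h1
  rw [lintegral_lintegral_swap] at h1
  · simpa only [lintegral_one_sub_cos_cauchyMeasure] using h1
  · refine Measurable.aemeasurable ?_
    unfold Function.uncurry; fun_prop

end BoundedVariation

/-! ### Necessity: the jumps of a nonnegative law are nonnegative -/

section Positivity

variable {d : ℕ} {μ ν : Measure (Space d)}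

/-- A finite nonzero intensity produces exactly n points with positive probability for each n, and
each point lowers the i-th coordinate by at least ε. -/
lemma exists_compoundPoisson_coord_le [IsFiniteMeasure ν] (hν0 : ν ≠ 0) (i : Fin d) {ε : ℝ}
    (hνε : ∀ᵐ x ∂ν, x i ≤ -ε) :
    ∃ μ₁ : Measure (Space d), IsProbabilityMeasure μ₁ ∧
      (∀ z, charFun μ₁ z =
        Complex.exp (∫ x, (Complex.exp (Complex.I * (⟪z, x⟫ : ℝ)) - 1) ∂ν)) ∧
      ∀ n : ℕ, μ₁ {x | x i ≤ -(n * ε)} ≠ 0 := by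
  obtain ⟨Ω, _, P, A, p, hP, h⟩ := exists_isPoissonPoints.{0} ν
  have hfin : ∫⁻ y, min ‖y‖ₑ 1 ∂ν < ∞ :=
    (lintegral_mono fun _ => min_le_right _ _).trans_lt (by simp)
  have hfin1 : ∫⁻ _, min ‖(1 : ℝ)‖ₑ 1 ∂ν < ∞ :=
    (lintegral_mono fun _ => min_le_right _ _).trans_lt (by simp)
  have hX := h.measurable_atomSum measurable_id
  have hK := h.measurable_atomSum (V := ℝ) (measurable_const (a := (1 : ℝ)))
  refine ⟨P.map (atomSum A p id), Measure.isProbabilityMeasure_map hX.aemeasurable,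
    fun z => ?_, fun n => ?_⟩
  · rw [charFun_eq_charFunDual_toDualMap, h.charFunDual_map_atomSum measurable_id hfin]
    simp
  -- Summing the constant 1 counts the active points.
  have hlaw : P.map (atomSum A p fun _ => (1 : ℝ)) =
      (poissonMeasure (ν Set.univ).toNNReal).map Nat.cast := by
    have : IsProbabilityMeasure (P.map (atomSum A p fun _ => (1 : ℝ))) :=
      Measure.isProbabilityMeasure_map hK.aemeasurable
    refine Measure.ext_of_charFun ?_
    ext t
    rw [charFun_map_cast_poissonMeasure, charFun_eq_charFunDual_toDualMap,
      h.charFunDual_map_atomSum measurable_const hfin1]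
    congr 1
    rw [integral_const, Complex.real_smul]
    rw [measureReal_def, ENNReal.coe_toNNReal_eq_toReal]
    simp [mul_comm]
  have hpos : P {ω | atomSum A p (fun _ => (1 : ℝ)) ω = n} ≠ 0 := by
    have h1 : P {ω | atomSum A p (fun _ => (1 : ℝ)) ω = n} =
        P.map (atomSum A p fun _ => (1 : ℝ)) {(n : ℝ)} :=
      (Measure.map_apply hK (measurableSet_singleton _)).symm
    have h2 : (Nat.cast : ℕ → ℝ) ⁻¹' {(n : ℝ)} = {n} := by ext; simp
    rw [h1, hlaw, Measure.map_apply (by fun_prop) (measurableSet_singleton _), h2,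
      poissonMeasure_singleton]
    have h3 : 0 < (ν Set.univ).toNNReal :=
      ENNReal.toNNReal_pos (by simpa using hν0) (measure_ne_top _ _)
    have h4 : (0 : ℝ) < ((ν Set.univ).toNNReal : ℝ) := by exact_mod_cast h3
    exact (ENNReal.ofReal_pos.2 (by positivity)).ne'
  have hle : ∀ᵐ ω ∂P, atomSum A p id ω i ≤ -(atomSum A p (fun _ => (1 : ℝ)) ω * ε) := by
    filter_upwards [h.ae_summable_norm measurable_id hfin,
      h.ae_summable_norm (measurable_const (a := (1 : ℝ))) hfin1, h.ae_forall_of_ae hνε]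
      with ω h1 h2 h3
    have h4 : HasSum (fun k => (A k).indicator (fun ω => id (p k ω)) ω i) (atomSum A p id ω i) :=
      h1.of_norm.hasSum.mapL (EuclideanSpace.proj i : Space d →L[ℝ] ℝ)
    have h5 := (h2.of_norm.hasSum.mul_right ε).neg
    refine hasSum_le (fun k => ?_) h4 h5
    by_cases hk : ω ∈ A k
    · simpa [hk] using h3 k hk
    · simp [hk]
  rw [Measure.map_apply hX (measurableSet_le (by fun_prop) measurable_const)]
  refine fun h0 => hpos (measure_mono_null_ae ?_ h0)
  filter_upwards [hle] with ω hω hn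
  have hn' : atomSum A p (fun _ => (1 : ℝ)) ω = n := hn
  rw [hn'] at hω
  exact hω

/-- Split off the jumps with i-th coordinate at most -ε as an independent compound Poisson factor.
It undercuts any level with positive probability, so whatever the remaining factor is, the
convolution charges {x_i < 0}. -/
theorem coord_nonneg_of_charFun [SFinite ν] [IsProbabilityMeasure μ] {γ : Space d}
    (hν : ∫⁻ y, min ‖y‖ₑ 1 ∂ν < ∞)
    (h : ∀ z, charFun μ z = Complex.exp (Complex.I * (⟪γ, z⟫ : ℝ) +
      ∫ x, (Complex.exp (Complex.I * (⟪z, x⟫ : ℝ)) - 1) ∂ν))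
    (i : Fin d) (h0 : μ {x | x i < 0} = 0) : ν {x | x i < 0} = 0 := by
  by_contra hcon
  have hunion : {x : Space d | x i < 0} = ⋃ k : ℕ, {x | x i ≤ -(1 / ((k : ℝ) + 1))} := by
    ext x
    simp only [Set.mem_ofPred_eq, Set.mem_iUnion]
    constructor
    · intro hx
      obtain ⟨k, hk⟩ := exists_nat_one_div_lt (neg_pos.2 hx)
      exact ⟨k, by linarith⟩
    · rintro ⟨k, hk⟩
      have : (0 : ℝ) < 1 / ((k : ℝ) + 1) := by positivity
      linarith
  rw [hunion] at hcon
  obtain ⟨k, hk⟩ : ∃ k : ℕ, ν {x | x i ≤ -(1 / ((k : ℝ) + 1))} ≠ 0 := by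
    by_contra hall
    push Not at hall
    exact hcon (measure_iUnion_null hall)
  set ε : ℝ := 1 / ((k : ℝ) + 1) with hε
  have hεpos : 0 < ε := by positivity
  have hε1 : ε ≤ 1 := by
    rw [hε, div_le_one (by positivity)]
    linarith [(Nat.cast_nonneg k : (0 : ℝ) ≤ k)]
  set B : Set (Space d) := {x | x i ≤ -ε} with hB
  have hBm : MeasurableSet B := measurableSet_le (by fun_prop) measurable_const
  have hBfin : ν B < ∞ := by
    -- Markov's inequality makes `B` of finite measure; ε ≤ 1 is what lets the truncated norm reach
    -- ε on `B`.
    have h1 := mul_meas_ge_le_lintegral (μ := ν) (f := fun y : Space d => min ‖y‖ₑ 1)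
      (by fun_prop) (ENNReal.ofReal ε)
    have h2 : B ⊆ {x | ENNReal.ofReal ε ≤ min ‖x‖ₑ 1} := fun x hx => by
      refine le_min ?_ (ENNReal.ofReal_le_one.2 hε1)
      rw [← ofReal_norm]
      refine ENNReal.ofReal_le_ofReal ?_
      have h4 : x i ≤ -ε := hx
      have h5 : ‖x i‖ ≤ ‖x‖ := PiLp.norm_apply_le x i
      rw [Real.norm_eq_abs] at h5
      linarith [neg_le_abs (x i)]
    refine (measure_mono h2).trans_lt ?_
    by_contra htop
    rw [not_lt_top_iff] at htop
    rw [htop, ENNReal.mul_top (ENNReal.ofReal_pos.2 hεpos).ne'] at h1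
    exact absurd hν (not_lt.2 h1)
  have : IsFiniteMeasure (ν.restrict B) := ⟨by simpa using hBfin⟩
  obtain ⟨μ₁, hμ₁, hc₁, hpos⟩ := exists_compoundPoisson_coord_le (ν := ν.restrict B)
    (by simpa using hk) i (ae_restrict_mem hBm)
  have hνc : ∫⁻ y, min ‖y‖ₑ 1 ∂(ν.restrict Bᶜ) < ∞ := (setLIntegral_le_lintegral _ _).trans_lt hν
  obtain ⟨μ₂, hμ₂, hc₂⟩ := exists_charFun_eq (ν.restrict Bᶜ) hνc
  set μ₃ : Measure (Space d) := (Measure.dirac γ) ∗ μ₂ with hμ₃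
  have heq : μ = μ₁ ∗ μ₃ := by
    refine Measure.ext_of_charFun ?_
    ext z
    rw [charFun_conv, hμ₃, charFun_conv, charFun_dirac, hc₁, hc₂, h,
      ← integral_add_compl hBm (integrable_exp_inner_sub_one hν z), ← Complex.exp_add,
      ← Complex.exp_add]
    congr 1; ring
  -- The second factor, drift included, is finite-valued, so some threshold nε exceeds its i-th
  -- coordinate with positive probability.
  obtain ⟨n, hn⟩ : ∃ n : ℕ, μ₃ {x | x i < n * ε} ≠ 0 := by
    by_contra hall
    push Not at hall
    have h1 : (Set.univ : Set (Space d)) = ⋃ n : ℕ, {x | x i < n * ε} := by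
      refine (Set.eq_univ_of_forall fun x => ?_).symm
      obtain ⟨n, hn⟩ := exists_nat_gt (x i / ε)
      exact Set.mem_iUnion.2 ⟨n, (div_lt_iff₀ hεpos).1 hn⟩
    have h2 : μ₃ Set.univ = 0 := by rw [h1]; exact measure_iUnion_null hall
    simp at h2
  have hle : (μ₁.prod μ₃) ({x | x i ≤ -(n * ε)} ×ˢ {x | x i < n * ε}) ≤ μ {x | x i < 0} := by
    rw [heq, Measure.conv, Measure.map_apply (by fun_prop)
      (measurableSet_lt (by fun_prop) measurable_const)]
    refine measure_mono fun x hx => ?_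
    have h1 : x.1 i ≤ -(n * ε) := hx.1
    have h2 : x.2 i < n * ε := hx.2
    show (x.1 + x.2) i < 0
    rw [PiLp.add_apply]
    linarith
  rw [h0, Measure.prod_prod] at hle
  exact mul_ne_zero (hpos n) hn (le_antisymm hle zero_le)

end Positivity

/-! ### Reading the constraints on α and λ from the Lévy measure. -/

section Necessity

variable {d : ℕ} {α : ℝ} {β : Sphere d → ℝ} {lam : Measure (Sphere d)}

lemma le_one_sub_exp_neg_mul_exp {c x : ℝ} (hc : 0 ≤ c) (hx : x ≤ 0) :
    c / (1 + c) * Real.exp x ≤ 1 - Real.exp (-(c * Real.exp x)) := by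
  have h1 : 0 ≤ c * Real.exp x := by positivity
  have h2 : Real.exp (-(c * Real.exp x)) ≤ 1 / (1 + c * Real.exp x) := by
    rw [Real.exp_neg, ← one_div]
    exact one_div_le_one_div_of_le (by positivity) (by linarith [Real.add_one_le_exp (c * Real.exp x)])
  have h3 : c / (1 + c) * Real.exp x ≤ c * Real.exp x / (1 + c * Real.exp x) := by
    rw [div_mul_eq_mul_div]
    have : Real.exp x ≤ 1 := Real.exp_le_one_iff.2 hx
    gcongr
    nlinarith
  have h4 : c * Real.exp x / (1 + c * Real.exp x) = 1 - 1 / (1 + c * Real.exp x) := by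
    field_simp; ring
  linarith

/-- For x ≤ 0 the density is at least a multiple of e^{-x} because α ≥ 1, and the other factor is at
least a multiple of e^x. The product stays above a positive constant on a half-line. -/
lemma lintegral_logDensity_mul_eq_top (hα : 1 ≤ α) (hβ : ∀ w, 0 < β w) (w : Sphere d) {c : ℝ}
    (hc : 0 < c) :
    ∫⁻ x, ENNReal.ofReal (logDensity α β w x) *
      ENNReal.ofReal (1 - Real.exp (-(c * Real.exp x))) = ∞ := by
  set K : ℝ := Real.exp (-β w) * (c / (1 + c)) with hK
  have hKpos : 0 < K := by positivity
  have hle : ∫⁻ x in Set.Iic (0 : ℝ), ENNReal.ofReal K ≤ ∫⁻ x, ENNReal.ofReal (logDensity α β w x) *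
      ENNReal.ofReal (1 - Real.exp (-(c * Real.exp x))) := by
    refine le_trans (setLIntegral_mono' measurableSet_Iic fun x hx => ?_)
      (setLIntegral_le_lintegral (Set.Iic (0 : ℝ)) _)
    have hx0 : x ≤ 0 := hx
    rw [← ENNReal.ofReal_mul (logDensity_pos _ _ _ _).le]
    refine ENNReal.ofReal_le_ofReal ?_
    have h1 := le_one_sub_exp_neg_mul_exp hc.le hx0
    have h2 : Real.exp (-β w) * Real.exp (-x) ≤ logDensity α β w x := by
      rw [logDensity, ← Real.exp_add]
      refine Real.exp_le_exp.2 ?_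
      have h3 : Real.exp x ≤ 1 := Real.exp_le_one_iff.2 hx0
      nlinarith [hβ w]
    calc K = Real.exp (-β w) * Real.exp (-x) * (c / (1 + c) * Real.exp x) := by
          have : Real.exp (-x) * Real.exp x = 1 := by rw [← Real.exp_add]; simp
          rw [hK]
          linear_combination (-(Real.exp (-β w) * (c / (1 + c)))) * this
      _ ≤ logDensity α β w x * (1 - Real.exp (-(c * Real.exp x))) := by
          gcongr
          exact (logDensity_pos _ _ _ _).le
  rw [setLIntegral_const, Real.volume_Iic,
    ENNReal.mul_top (ENNReal.ofReal_pos.2 hKpos).ne'] at hle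
  exact top_le_iff.1 hle

lemma exists_coord_ne_zero (w : Sphere d) : ∃ i, (w : Space d) i ≠ 0 := by
  by_contra hall
  push Not at hall
  have h1 : (w : Space d) = 0 := by ext i; exact hall i
  have h2 := norm_eq_of_mem_sphere w
  rw [h1, norm_zero] at h2
  exact zero_ne_one h2

lemma lt_one_of_lintegral_one_sub_exp [SFinite lam] (hβm : Measurable β) (hβ : ∀ w, 0 < β w)
    (hlam : lam ≠ 0)
    (h : ∀ i, ∫⁻ x, ENNReal.ofReal (1 - Real.exp (-|x i|)) ∂(levyMeasure α β lam) < ∞) :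
    α < 1 := by
  by_contra hα
  rw [not_lt] at hα
  have hae : ∀ᵐ w ∂lam, ∀ i : Fin d, ∫⁻ x, ENNReal.ofReal (logDensity α β w x) *
      ENNReal.ofReal (1 - Real.exp (-|(Real.exp x • (w : Space d)) i|)) < ∞ := by
    rw [ae_all_iff]
    intro i
    have h1 := h i
    rw [lintegral_levyMeasure α hβm _ (by fun_prop)] at h1
    refine ae_lt_top ?_ h1.ne
    refine Measurable.lintegral_prod_right' (f := fun p : Sphere d × ℝ =>
      ENNReal.ofReal (logDensity α β p.1 p.2) *
        ENNReal.ofReal (1 - Real.exp (-|(Real.exp p.2 • (p.1 : Space d)) i|))) ?_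
    exact (measurable_logDensity α hβm).ennreal_ofReal.mul (by fun_prop)
  have : NeBot (ae lam) := ae_neBot.2 hlam
  obtain ⟨w, hw⟩ := hae.exists
  obtain ⟨i, hi⟩ := exists_coord_ne_zero w
  have h2 := hw i
  have h3 : ∀ x : ℝ, |(Real.exp x • (w : Space d)) i| = |(w : Space d) i| * Real.exp x := fun x => by
    rw [PiLp.smul_apply, smul_eq_mul, abs_mul, abs_of_pos (Real.exp_pos x), mul_comm]
  simp only [h3] at h2
  rw [lintegral_logDensity_mul_eq_top hα hβ w (abs_pos.2 hi)] at h2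
  exact lt_irrefl _ h2

/-- A direction w with w_i < 0 keeps its whole ray in {x_i < 0}, and the radial density is strictly
positive, so almost no such direction is charged. -/
lemma compl_positiveSphere_null [SFinite lam] (hβm : Measurable β)
    (h : ∀ i, levyMeasure α β lam {x | x i < 0} = 0) : lam (positiveSphere d)ᶜ = 0 := by
  have hae : ∀ᵐ w ∂lam, ∀ i : Fin d, ∫⁻ x, ENNReal.ofReal (logDensity α β w x) *
      ({x : Space d | x i < 0}.indicator 1 (Real.exp x • (w : Space d))) = 0 := by
    rw [ae_all_iff]
    intro i
    have hm : MeasurableSet {x : Space d | x i < 0} :=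
      measurableSet_lt (by fun_prop) measurable_const
    have h1 := h i
    have hk : Measurable ({x : Space d | x i < 0}.indicator (1 : Space d → ℝ≥0∞)) :=
      measurable_one.indicator hm
    rw [← lintegral_indicator_one hm, lintegral_levyMeasure α hβm _ hk,
      lintegral_eq_zero_iff] at h1
    · exact h1
    · refine Measurable.lintegral_prod_right' (f := fun p : Sphere d × ℝ =>
        ENNReal.ofReal (logDensity α β p.1 p.2) *
          ({x : Space d | x i < 0}.indicator 1 (Real.exp p.2 • (p.1 : Space d)))) ?_
      exact (measurable_logDensity α hβm).ennreal_ofReal.mul (hk.comp (by fun_prop))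
  refine measure_mono_null_ae (s := (positiveSphere d)ᶜ) (t := ∅) ?_ measure_empty
  filter_upwards [hae] with w hw hneg
  obtain ⟨i, hi⟩ : ∃ i, (w : Space d) i < 0 := by
    by_contra hall
    push Not at hall
    exact hneg hall
  have h1 := hw i
  have h2 : ∀ x : ℝ, Real.exp x • (w : Space d) ∈ {x : Space d | x i < 0} := fun x => by
    show (Real.exp x • (w : Space d)) i < 0
    rw [PiLp.smul_apply, smul_eq_mul]
    exact mul_neg_of_pos_of_neg (Real.exp_pos x) hi
  simp only [Set.indicator_of_mem (h2 _), Pi.one_apply, mul_one] at h1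
  rw [lintegral_eq_zero_iff (continuous_logDensity w).measurable.ennreal_ofReal] at h1
  obtain ⟨x, hx⟩ := h1.exists
  exact (ENNReal.ofReal_pos.2 (logDensity_pos α β w x)).ne' hx

theorem lt_one_and_compl_positiveSphere_null {μ : Measure (Space d)} [IsFiniteMeasure lam] (hα : 0 < α) (hβm : Measurable β)
    (hβ : ∀ w, 0 < β w) (hlam : lam ≠ 0) (hμ : IsETaSLaw α β lam μ)
    (h0 : ∀ i, μ {x | x i < 0} = 0) :
    α ∈ Set.Ioo (0 : ℝ) 1 ∧ lam (positiveSphere d)ᶜ = 0 := by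
  obtain ⟨hprob, hid, γ, hLK⟩ := hμ
  have hα1 : α < 1 := lt_one_of_lintegral_one_sub_exp hβm hβ hlam fun i =>
    lintegral_one_sub_exp_lt_top hid hLK i (h0 i)
  have hν := lintegral_min_norm_levyMeasure_lt_top (lam := lam) ⟨hα, hα1⟩ hβm hβ
  -- Once α < 1 the compensator is integrable on its own and can be absorbed into the drift.
  refine ⟨⟨hα, hα1⟩, compl_positiveSphere_null hβm fun i =>
    coord_nonneg_of_charFun (γ := γ - ∫ x in Metric.closedBall (0 : Space d) 1, x
      ∂(levyMeasure α β lam)) hν (fun z => ?_) i (h0 i)⟩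
  rw [hLK.2, integral_levyKhintchine_eq hν, inner_sub_left]
  congr 1
  push_cast; ring

lemma IsSatoSubordinator.map_one_coord_neg {q : ℝ} {Ω : Type u} [MeasurableSpace Ω]
    {P : Measure Ω} {S : ℝ≥0 → Ω → Space d} (h : IsSatoSubordinator q S P) (i : Fin d) :
    P.map (S 1) {x | x i < 0} = 0 := by
  rw [Measure.map_apply (h.sato.additive.measurable 1)
    (measurableSet_lt (by fun_prop) measurable_const)]
  have : ∀ᵐ ω ∂P, ¬ (S 1 ω i < 0) := by
    filter_upwards [h.nonneg] with ω hω using not_lt.2 (hω i 1)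
  simpa [ae_iff] using this

end Necessity

end ETaS

theorem proposition3p1 {d : ℕ} (α : ℝ) (hα : α ∈ Set.Ioo (0 : ℝ) 2)
    (β : ETaS.Sphere d → ℝ) (hβ_meas : Measurable β) (hβ_pos : ∀ w, 0 < β w)
    (lam : MeasureTheory.Measure (ETaS.Sphere d)) [MeasureTheory.IsFiniteMeasure lam]
    (hlam : lam ≠ 0) (q : ℝ) (hq : 0 < q) :
    (ETaS.ExistsSatoSubordinator.{u} q α β lam ↔
      α ∈ Set.Ioo (0 : ℝ) 1 ∧ lam (ETaS.positiveSphere d)ᶜ = 0) ∧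
    (ETaS.ExistsDriftlessSatoSubordinator.{u} q α β lam ↔
      α ∈ Set.Ioo (0 : ℝ) 1 ∧ lam (ETaS.positiveSphere d)ᶜ = 0) := by
  have hforget : ETaS.ExistsDriftlessSatoSubordinator.{u} q α β lam →
      ETaS.ExistsSatoSubordinator.{u} q α β lam := fun ⟨Ω, mΩ, P, S, hP, hS, hlaw, _⟩ =>
    ⟨Ω, mΩ, P, S, hP, hS, hlaw⟩
  have hnec : ETaS.ExistsSatoSubordinator.{u} q α β lam →
      α ∈ Set.Ioo (0 : ℝ) 1 ∧ lam (ETaS.positiveSphere d)ᶜ = 0 :=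
    fun ⟨_, _, _, _, _, hS, hlaw⟩ =>
      ETaS.lt_one_and_compl_positiveSphere_null hα.1 hβ_meas hβ_pos hlam hlaw hS.map_one_coord_neg
  have hsuff : α ∈ Set.Ioo (0 : ℝ) 1 ∧ lam (ETaS.positiveSphere d)ᶜ = 0 →
      ETaS.ExistsDriftlessSatoSubordinator.{u} q α β lam := fun h =>
    ETaS.existsDriftlessSatoSubordinator h.1 hβ_meas hβ_pos hq hlam h.2
  exact ⟨⟨hnec, fun h => hforget (hsuff h)⟩, ⟨fun h => hnec (hforget h), hsuff⟩⟩
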